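/- Let $n\ge 1$ and let $G$ be a homogeneous group with underlying manifold $\mathbb R^n$: a connected, simply connected nilpotent Lie group, written in exponential coordinates, such that the dilations $\delta_r x=(r^{a_1}x_1,\dots,r^{a_n}x_n)$, $r>0$, with weights $1=a_1\le\dots\le a_n$, are automorphisms. Put $Q=\sum_i a_i$, and $|\alpha|=\sum_i a_i\alpha_i$ for a multiindex $\alpha$. Let $|\cdot|$ be a homogeneous norm on $G$: continuous, nonnegative, smooth away from $0$, vanishing only at the identity, with $|x^{-1}|=|x|$ and $|\delta_r x|=r|x|$. Let $j\in\mathbb R$. $\mathcal M^j(G)$ is the space of $m\in C^\infty(\mathbb R^n)$ such that for every $\alpha$ there is $C_\alpha$ with $|\partial^\alpha m(\xi)|\le C_\alpha(1+|\xi|)^{j-|\alpha|}$ for all $\xi$; for $N\in\mathbb N$, $\|m\|_{\mathcal M^j,N}=\sum_{|\alpha|\le N}\sup_\xi (1+|\xi|)^{|\alpha|-j}|\partial^\alpha m(\xi)|$. $\check{\mathcal M}^j(G)\subseteq\mathcal S'$ is the space of inverse Fourier transforms of elements of $\mathcal M^j(G)$ (the Fourier transform is the Euclidean one on $\mathbb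 R^n$). $\mathcal S=\mathcal S(G)$ is the Schwartz space of $\mathbb R^n$, with the increasing family of norms $\|f\|_{\mathcal S,N}=\max_{k,l\le N}\sup_x\|x\|^k\|D^lf(x)\|$; $\mathcal S_o$ is the space of $f\in\mathcal S$ all of whose moments $\int x^\alpha f(x)\,dx$ vanish; $\hat{\mathcal S}_o$ is its image under the Fourier transform; and $\mathcal E'$ is the space of compactly supported distributions. Sums over $k$ are over $k\ge 0$, and convergence of a series in $\mathcal S'$ or in a function space means convergence of its partial sums. 1. If $m\in\mathcal M^j(G)$, there is a bounded sequence $\{\psi_k\}_{k\ge0}$ in $\mathcal S$, with $\psi_k\in\hat{\mathcal S}_o$ for $k\ge1$, such that $m=\sum_k m_k$ pointwise and in $\mathcal S'$, where $m_k=2^{jk}\,\psi_k\circ\delta_{2^{-k}}$. For any $\psi_k\in\mathcal S$ one has $\check m_k=2^{(j+Q)k}\,\check\psi_k\circ\delta_{2^k}$. 2. Let $\{\psi_k\}_{k\ge 0}$ be a bounded sequence in $\mathcal S$ with $\psi_k\in\hat{\mathcal S}_o$ for $k\ge1$, and $m_k=2^{jk}\,\psi_k\circ\delta_{2^{-k}}$.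 (a) $\sum_k m_k$ converges in $C^\infty$ and in $\mathcal S'$ to an element $m\in\mathcal M^j(G)$. (b) For every $I$ there are $C,J$, not depending on the sequence, with $\|\sum_k m_k\|_{\mathcal M^j,I}\le C\sup_k\|\psi_k\|_{\mathcal S,J}$. (c) For every $j'>j$ and every $I$ there are $C,J$, not depending on the sequence, with $\|\sum_k m_k\|_{\mathcal M^{j'},I}\le C\sup_k 2^{-(j'-j)k}\|\psi_k\|_{\mathcal S,J}$. (d) $\sum_k m_k$ converges to $m$ in $\mathcal M^{j'}(G)$ for every $j'>j$. 3. A tempered distribution $K$ lies in $\check{\mathcal M}^j(G)$ if and only if $K=\sum_k f_k$ with convergence in $\mathcal S'$, where $f_k=2^{(j+Q)k}\,\varphi_k\circ\delta_{2^k}$ for some bounded sequence $\{\varphi_k\}_{k\ge0}$ in $\mathcal S$ with $\varphi_k\in\mathcal S_o$ for $k\ge1$. Conversely, for every such sequence $\{\varphi_k\}$ the series $\sum_k f_k$ converges in $\mathcal S'$ to an element of $\check{\mathcal M}^j(G)$. Moreover $\check{\mathcal M}^j(G)\subseteq\mathcal E'+\mathcal S$, and every $K\in\check{\mathcal M}^j(G)$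 is smooth away from $0$. Finally, if $K=\sum_k f_k\in\check{\mathcal M}^j(G)$ is as above and $\zeta\in C_c^\infty$ equals $1$ in a neighborhood of $0$, then $(1-\zeta)K=\sum_k(1-\zeta)f_k$, where the sum converges absolutely in $\mathcal S$. -/

import Mathlib

open Filter Topology MeasureTheory
open scoped SchwartzMap FourierTransform ContDiff

noncomputable section

/-- A homogeneous group of dimension `n ≥ 1`, in exponential coordinates: a nilpotent Lie group law on
`ℝⁿ` (hence connected and simply connected) for which the exponential map is the identity,
i.e. the one-parameter subgroups are the lines `t ↦ t • x`, together with weights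
`1 = a₁ ≤ … ≤ aₙ` such that the dilations `δ_r x = (r ^ a₁ x₁, …, r ^ aₙ xₙ)`, `r > 0`, are group
automorphisms. -/
structure HomogeneousGroup (n : ℕ) [NeZero n] extends Group (EuclideanSpace ℝ (Fin n)) where
  contDiff_mul : ContDiff ℝ ∞
    (fun p : EuclideanSpace ℝ (Fin n) × EuclideanSpace ℝ (Fin n) => p.1 * p.2)
  smul_mul_smul_same : ∀ (s t : ℝ) (x : EuclideanSpace ℝ (Fin n)),
    (s • x) * (t • x) = (s + t) • x
  nilpotent : Group.IsNilpotent (EuclideanSpace ℝ (Fin n))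
  weight : Fin n → ℝ
  weight_mono : Monotone weight
  weight_zero : weight 0 = 1
  dilation_mul : ∀ r : ℝ, 0 < r → ∀ x y : EuclideanSpace ℝ (Fin n),
    WithLp.toLp 2 (fun i => r ^ weight i * (x * y) i) =
      WithLp.toLp 2 (fun i => r ^ weight i * x i) * WithLp.toLp 2 (fun i => r ^ weight i * y i)

namespace HomogeneousGroup

variable {n : ℕ} [NeZero n] (G : HomogeneousGroup n)

theorem one_le_weight (i : Fin n) : 1 ≤ G.weight i := by
  rw [← G.weight_zero]
  exact G.weight_mono (Fin.zero_le i)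

/-- In exponential coordinates the identity element is the origin. -/
theorem one_eq_zero : G.one = 0 := by
  let _ := G.toGroup
  have h := G.smul_mul_smul_same 0 0 0
  simp only [smul_zero] at h
  exact (mul_eq_left.mp h).symm

/-- In exponential coordinates the inverse of `x` is `-x`. -/
theorem inv_eq_neg (x : EuclideanSpace ℝ (Fin n)) : G.inv x = -x := by
  let _ := G.toGroup
  have h := G.smul_mul_smul_same 1 (-1) x
  have h0 : (0 : EuclideanSpace ℝ (Fin n)) = 1 := G.one_eq_zero.symm
  simp only [one_smul, neg_smul, add_neg_cancel, zero_smul] at h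
  exact inv_eq_of_mul_eq_one_right (h.trans h0)

/-- The homogeneous dimension `Q`. -/
def homDim : ℝ := ∑ i, G.weight i

/-- The dilation `δ_r`, `r > 0`. -/
def dilation (r : ℝ) (hr : 0 < r) :
    EuclideanSpace ℝ (Fin n) ≃L[ℝ] EuclideanSpace ℝ (Fin n) :=
  LinearEquiv.toContinuousLinearEquiv
    { toFun := fun x => WithLp.toLp 2 (fun i => r ^ G.weight i * x i)
      map_add' := fun x y => by ext i; simp [mul_add]
      map_smul' := fun c x => by ext i; simp; ring
      invFun := fun x => WithLp.toLp 2 (fun i => (r ^ G.weight i)⁻¹ * x i)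
      left_inv := fun x => by
        ext i
        have h : r ^ G.weight i ≠ 0 := (Real.rpow_pos_of_pos hr _).ne'
        simp [h]
      right_inv := fun x => by
        ext i
        have h : r ^ G.weight i ≠ 0 := (Real.rpow_pos_of_pos hr _).ne'
        simp [h] }

theorem dilation_apply (r : ℝ) (hr : 0 < r) (x : EuclideanSpace ℝ (Fin n)) (i : Fin n) :
    G.dilation r hr x i = r ^ G.weight i * x i := rfl

/-- The composition `f ∘ δ_{2 ^ k}` of a Schwartz function with a dyadic dilation, `k ∈ ℤ`. -/
def dyadicComp (k : ℤ) (f : 𝓢(EuclideanSpace ℝ (Fin n), ℂ)) :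
    𝓢(EuclideanSpace ℝ (Fin n), ℂ) :=
  SchwartzMap.compCLMOfContinuousLinearEquiv ℂ (G.dilation ((2 : ℝ) ^ k) (by positivity)) f

/-- A homogeneous norm on `G`. -/
structure HomogeneousNorm where
  toFun : EuclideanSpace ℝ (Fin n) → ℝ
  nonneg : ∀ x, 0 ≤ toFun x
  continuous : Continuous toFun
  smooth : ContDiffOn ℝ ∞ toFun {0}ᶜ
  eq_zero_iff : ∀ x, toFun x = 0 ↔ x = G.one
  map_inv : ∀ x, toFun (G.inv x) = toFun x
  map_dilation : ∀ (r : ℝ) (hr : 0 < r) (x), toFun (G.dilation r hr x) = r * toFun x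

/-- The weighted length `|α| = ∑ aᵢ αᵢ` of a multiindex. -/
def weightedLength (α : Fin n → ℕ) : ℝ := ∑ i, G.weight i * α i

/-- The finite set of multiindices with `|α| ≤ N`. -/
def multiIndices (N : ℕ) : Finset (Fin n → ℕ) :=
  (Fintype.piFinset fun _ => Finset.range (N + 1)).filter fun α => G.weightedLength α ≤ N

theorem mem_multiIndices (N : ℕ) (α : Fin n → ℕ) :
    α ∈ G.multiIndices N ↔ G.weightedLength α ≤ N := by
  simp only [multiIndices, Finset.mem_filter, Fintype.mem_piFinset, Finset.mem_range,
    and_iff_right_iff_imp]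
  intro h i
  have h1 : (α i : ℝ) ≤ G.weight i * α i :=
    le_mul_of_one_le_left (Nat.cast_nonneg _) (G.one_le_weight i)
  have h2 : G.weight i * α i ≤ G.weightedLength α :=
    Finset.single_le_sum (f := fun i => G.weight i * (α i : ℝ))
      (fun k _ => mul_nonneg (zero_le_one.trans (G.one_le_weight k)) (Nat.cast_nonneg _))
      (Finset.mem_univ i)
  have h3 : (α i : ℝ) ≤ N := h1.trans (h2.trans h)
  exact Nat.lt_succ_of_le (by exact_mod_cast h3)

end HomogeneousGroup

/-- The partial derivative `∂^α f` of a smooth function: the iterated derivative in `αᵢ` copies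
of the `i`-th basis vector for each `i`. -/
def multiDeriv {n : ℕ} (α : Fin n → ℕ) (f : EuclideanSpace ℝ (Fin n) → ℂ)
    (x : EuclideanSpace ℝ (Fin n)) : ℂ :=
  iteratedFDeriv ℝ (∑ i, α i) f x
    fun k => EuclideanSpace.single (finSigmaFinEquiv.symm k).1 (1 : ℝ)

/-- The space `𝓢ₒ` of Schwartz functions all of whose moments vanish. -/
def schwartzZeroMoments (n : ℕ) : Set 𝓢(EuclideanSpace ℝ (Fin n), ℂ) :=
  {f | ∀ α : Fin n → ℕ, ∫ x, (∏ i, ((x i : ℂ)) ^ α i) * f x = 0}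

/-- The image of `𝓢ₒ` under the Fourier transform. -/
def schwartzZeroMomentsHat (n : ℕ) : Set 𝓢(EuclideanSpace ℝ (Fin n), ℂ) :=
  (fun f => 𝓕 f) '' schwartzZeroMoments n

/-- An increasing family of norms that defines the topology of the Schwartz space:
the maximum over `k, l ≤ N` of `sup_x ‖x‖ ^ k * ‖D ^ l f x‖`. -/
def schwartzNorm {n : ℕ} (N : ℕ) (f : 𝓢(EuclideanSpace ℝ (Fin n), ℂ)) : ℝ :=
  (Finset.Iic (N, N)).sup (schwartzSeminormFamily ℂ (EuclideanSpace ℝ (Fin n)) ℂ) f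

/-- A sequence that is bounded in `𝓢` and whose terms with index `k ≥ 1` lie in `A`. -/
def IsBoundedSeqIn {n : ℕ} (A : Set 𝓢(EuclideanSpace ℝ (Fin n), ℂ))
    (φ : ℕ → 𝓢(EuclideanSpace ℝ (Fin n), ℂ)) : Prop :=
  Bornology.IsVonNBounded ℂ (Set.range φ) ∧ ∀ k, 1 ≤ k → φ k ∈ A

/-- A Schwartz function as a tempered distribution. -/
def schwartzToDist {n : ℕ} (f : 𝓢(EuclideanSpace ℝ (Fin n), ℂ)) :
    𝓢'(EuclideanSpace ℝ (Fin n), ℂ) :=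
  SchwartzMap.toTemperedDistributionCLM (EuclideanSpace ℝ (Fin n)) ℂ volume f

/-- The tempered distribution `T` is given by integration against the function `m`. -/
def IsGivenBy {n : ℕ} (T : 𝓢'(EuclideanSpace ℝ (Fin n), ℂ))
    (m : EuclideanSpace ℝ (Fin n) → ℂ) : Prop :=
  ∀ g : 𝓢(EuclideanSpace ℝ (Fin n), ℂ),
    Integrable (fun ξ => g ξ * m ξ) ∧ T g = ∫ ξ, g ξ * m ξ

/-- Convergence in `C^∞`: every partial derivative converges uniformly on compact sets. -/
def TendstoSmooth {n : ℕ} (F : ℕ → EuclideanSpace ℝ (Fin n) → ℂ)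
    (m : EuclideanSpace ℝ (Fin n) → ℂ) : Prop :=
  ∀ (α : Fin n → ℕ) (B : Set (EuclideanSpace ℝ (Fin n))), IsCompact B →
    TendstoUniformlyOn (fun N => multiDeriv α (F N)) (multiDeriv α m) atTop B

/-- The tempered distribution `K` is given by a smooth function on the complement of `0`. -/
def IsSmoothAwayFromZero {n : ℕ} (K : 𝓢'(EuclideanSpace ℝ (Fin n), ℂ)) : Prop :=
  ∃ h : EuclideanSpace ℝ (Fin n) → ℂ, ContDiffOn ℝ ∞ h {0}ᶜ ∧
    ∀ g : 𝓢(EuclideanSpace ℝ (Fin n), ℂ), HasCompactSupport g → tsupport g ⊆ {0}ᶜ →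
      K g = ∫ x, g x * h x

namespace HomogeneousGroup

variable {n : ℕ} [NeZero n] {G : HomogeneousGroup n}

/-- The space `𝓜^j(G)` of multipliers of order `j`. -/
def multipliers (ν : G.HomogeneousNorm) (j : ℝ) : Set (EuclideanSpace ℝ (Fin n) → ℂ) :=
  {m | ContDiff ℝ ∞ m ∧ ∀ α : Fin n → ℕ, ∃ C : ℝ, 0 < C ∧
    ∀ ξ, ‖multiDeriv α m ξ‖ ≤ C * (1 + ν.toFun ξ) ^ (j - G.weightedLength α)}

/-- The norm `‖m‖_{𝓜^j, N}` of a multiplier: the sum over `|α| ≤ N` of the supremum norms of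
`(1 + |ξ|) ^ (|α| - j) * ∂^α m`. -/
def multiplierNorm (ν : G.HomogeneousNorm) (j : ℝ) (N : ℕ)
    (m : EuclideanSpace ℝ (Fin n) → ℂ) : ℝ :=
  ∑ α ∈ G.multiIndices N,
    ⨆ ξ, (1 + ν.toFun ξ) ^ (G.weightedLength α - j) * ‖multiDeriv α m ξ‖

/-- The space of inverse Fourier transforms of multipliers of order `j`. -/
def multipliersCheck (ν : G.HomogeneousNorm) (j : ℝ) : Set 𝓢'(EuclideanSpace ℝ (Fin n), ℂ) :=
  {K | ∃ m ∈ multipliers ν j, ∃ T : 𝓢'(EuclideanSpace ℝ (Fin n), ℂ), IsGivenBy T m ∧ K = 𝓕⁻ T}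

/-- The function `m_k = 2 ^ (j k) ψ_k ∘ δ_{2 ^ (-k)}`. -/
def multTerm (G : HomogeneousGroup n) (j : ℝ) (ψ : ℕ → 𝓢(EuclideanSpace ℝ (Fin n), ℂ)) (k : ℕ) :
    𝓢(EuclideanSpace ℝ (Fin n), ℂ) :=
  (((2 : ℝ) ^ (j * k) : ℝ) : ℂ) • G.dyadicComp (-(k : ℤ)) (ψ k)

/-- The function `f_k = 2 ^ ((j + Q) k) φ_k ∘ δ_{2 ^ k}`. -/
def kernelTerm (G : HomogeneousGroup n) (j : ℝ) (φ : ℕ → 𝓢(EuclideanSpace ℝ (Fin n), ℂ)) (k : ℕ) :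
    𝓢(EuclideanSpace ℝ (Fin n), ℂ) :=
  (((2 : ℝ) ^ ((j + G.homDim) * k) : ℝ) : ℂ) • G.dyadicComp (k : ℤ) (φ k)

end HomogeneousGroup

end

/-!
A multiplier of order `j` is a sum of dyadic pieces `2 ^ (j k) ψ_k ∘ δ_{2 ^ (-k)}` with `ψ_k` bounded
in the Schwartz space, and conversely every such series is a multiplier, provided that the `ψ_k`,
`k ≥ 1`, are flat at the origin. Flatness at the origin is exactly the vanishing of all moments of the
inverse Fourier transform (`mem_schwartzZeroMomentsHat_iff`), because derivatives at `0` of a Fourier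
transform are moments.

For the converse direction, Taylor's formula turns flatness into decay of arbitrary order at the
origin, and the Schwartz seminorms give decay of arbitrary order at infinity. With
`w = 1 + |ξ|` this gives
`|∂^α m_k(ξ)| ≤ C w ^ (j - |α|) min (w / 2 ^ k, 2 ^ k / w)`
(`HomogeneousGroup.exists_multiDeriv_multTerm_bound`), with `C` a multiple of a Schwartz norm of
`ψ_k`. The dyadic sum of the minimum is bounded uniformly in `w` (`sum_range_min_dyadic_le`), whence
the estimate of order `j`. The estimate of order `j' > j` is the same one applied to
`2 ^ (-(j' - j) k) ψ_k`, and applied to truncated sequences it yields convergence in order `j'`.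
Locally the terms are `O(2 ^ (-k))` with all derivatives, so that the series converges in `C^∞`, and
dominated convergence gives convergence as tempered distributions.

For the direct part one takes a dyadic partition of unity built from a bump function and the dilations
(`HomogeneousGroup.exists_dyadic_decomposition`). After rescaling, all pieces live on one annulus that
avoids the origin, where the symbol estimates become uniform bounds. Symbol estimates concern the
partial derivatives `∂^α` while Schwartz seminorms concern the full iterated derivative; the two are
linked by the symmetry of iterated derivatives (`iteratedFDeriv_single_eq_multiDeriv`).

The statements on kernels follow by the inverse Fourier transform, which exchanges the two kinds of
dyadic terms (`HomogeneousGroup.fourierInv_multTerm`). Away from the origin `‖δ_{2 ^ k} x‖` is at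
least `2 ^ k ‖x‖`, so the rapid decay of `φ_k` makes the pieces of the kernel geometrically small in
every Schwartz seminorm (`HomogeneousGroup.exists_kernelTerm_bound`). This gives absolute convergence
after multiplication by `1 - ζ`, and with it the smoothness away from the origin and the splitting
`K = ζ K + (1 - ζ) K`.
-/

/-! ### Iterated derivatives in coordinates -/

theorem natCast_le_infty (l : ℕ) : (l : WithTop ℕ∞) ≤ ∞ := mod_cast le_top

section IteratedDeriv

variable {E F : Type*} [NormedAddCommGroup E] [NormedSpace ℝ E]
  [NormedAddCommGroup F] [NormedSpace ℝ F]

theorem iteratedFDeriv_comp_swap_castSucc_succ {f : E → F} (hf : ContDiff ℝ ∞ f) :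
    ∀ (l : ℕ) (i : Fin l) (x : E) (v : Fin (l + 1) → E),
      iteratedFDeriv ℝ (l + 1) f x (v ∘ Equiv.swap i.castSucc i.succ) =
        iteratedFDeriv ℝ (l + 1) f x v := by
  have hd (l : ℕ) : ContDiff ℝ ∞ (iteratedFDeriv ℝ l f) :=
    hf.iteratedFDeriv_right (m := ∞) (mod_cast le_top)
  have hdd (l : ℕ) : Differentiable ℝ (iteratedFDeriv ℝ l f) := (hd l).differentiable (by simp)
  intro l
  induction l with
  | zero => exact fun i => i.elim0
  | succ l ih =>
    intro i x v
    rw [iteratedFDeriv_succ_apply_left, iteratedFDeriv_succ_apply_left]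
    induction i using Fin.cases with
    | zero =>
      have key (a b : E) (w : Fin l → E) :
          fderiv ℝ (iteratedFDeriv ℝ (l + 1) f) x a (Fin.cons b w) =
            fderiv ℝ (fderiv ℝ (iteratedFDeriv ℝ l f)) x a b w := by
        have h1 : DifferentiableAt ℝ (fderiv ℝ (iteratedFDeriv ℝ l f)) x :=
          ((hd l).fderiv_right (m := ∞) (by simp)).differentiable (by simp) x
        rw [← fderiv_continuousMultilinear_apply_const_apply (hdd (l + 1) x)]
        simp only [iteratedFDeriv_succ_apply_left, Fin.cons_zero, Fin.tail_cons]
        rw [fderiv_continuousMultilinear_apply_const_apply (h1.clm_apply (by fun_prop)),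
          fderiv_clm_apply h1 (by fun_prop)]
        simp
      have e1 : Fin.tail v = Fin.cons (v 1) (Fin.tail (Fin.tail v)) := by
        rw [← Fin.cons_self_tail (Fin.tail v)]; rfl
      have e2 : Fin.tail (v ∘ Equiv.swap (Fin.castSucc 0) (Fin.succ 0)) =
          Fin.cons (v 0) (Fin.tail (Fin.tail v)) := by
        funext j
        induction j using Fin.cases with
        | zero => simp [Fin.tail]
        | succ j =>
          simp only [Fin.tail, Function.comp, Fin.cons_succ]
          rw [Equiv.swap_apply_of_ne_of_ne]
          · simp [Fin.ext_iff]
          · simp [Fin.ext_iff]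
      rw [e1, e2, key, key]
      have := ((hd l).contDiffAt (x := x)).isSymmSndFDerivAt
        (by simpa using natCast_le_infty 2) (v 0) (v 1)
      simp [this]
    | succ i =>
      have e1 : (v ∘ Equiv.swap i.succ.castSucc i.succ.succ) 0 = v 0 := by
        simp only [Function.comp]
        rw [Equiv.swap_apply_of_ne_of_ne]
        · simp [Fin.ext_iff]
        · simp [Fin.ext_iff]
      have e2 : Fin.tail (v ∘ Equiv.swap i.succ.castSucc i.succ.succ) =
          Fin.tail v ∘ Equiv.swap i.castSucc i.succ := by
        funext j
        simp only [Fin.tail, Function.comp]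
        congr 1
        rw [← Fin.succ_castSucc, Equiv.swap_apply_def, Equiv.swap_apply_def]
        simp only [Fin.succ_inj]
        split_ifs <;> rfl
      rw [e1, e2, ← fderiv_continuousMultilinear_apply_const_apply (hdd (l + 1) x),
        ← fderiv_continuousMultilinear_apply_const_apply (hdd (l + 1) x)]
      simp only [ih]

/-- Iterated derivatives of a smooth function are symmetric: adjacent transpositions, which
generate the symmetric group, reduce to the symmetry of second derivatives. -/
theorem iteratedFDeriv_comp_perm_of_contDiff {f : E → F} (hf : ContDiff ℝ ∞ f) {l : ℕ}
    (σ : Equiv.Perm (Fin l)) (x : E) (v : Fin l → E) :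
    iteratedFDeriv ℝ l f x (v ∘ σ) = iteratedFDeriv ℝ l f x v := by
  cases l with
  | zero => congr; exact Subsingleton.elim _ _
  | succ l =>
    have hσ : σ ∈ Submonoid.closure
        (Set.range fun i : Fin l => Equiv.swap i.castSucc i.succ) := by
      rw [Equiv.Perm.mclosure_swap_castSucc_succ]; trivial
    induction hσ using Submonoid.closure_induction generalizing v with
    | mem τ hτ =>
      obtain ⟨i, rfl⟩ := hτ
      exact iteratedFDeriv_comp_swap_castSucc_succ hf l i x v
    | one => rfl
    | mul σ τ _ _ h1 h2 =>
      rw [Equiv.Perm.coe_mul, ← Function.comp_assoc, h2, h1]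

end IteratedDeriv

section MultiDeriv

variable {n : ℕ}

/-- The multiindex that counts how often each index occurs in the tuple `c`. -/
def multiCount {n l : ℕ} (c : Fin l → Fin n) : Fin n → ℕ :=
  fun i => Fintype.card {k // c k = i}

theorem prod_comp_eq_prod_pow_multiCount {M : Type*} [CommMonoid M] {l : ℕ} (c : Fin l → Fin n)
    (a : Fin n → M) : ∏ k, a (c k) = ∏ i, a i ^ multiCount c i := by
  rw [← Fintype.prod_fiberwise c]
  refine Finset.prod_congr rfl fun i _ => ?_
  rw [multiCount, ← Finset.card_univ]
  exact Finset.prod_eq_pow_card fun k _ => by rw [k.2]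

theorem prod_finSigmaFinEquiv_symm_eq_prod_pow {M : Type*} [CommMonoid M] (α : Fin n → ℕ)
    (a : Fin n → M) :
    ∏ k : Fin (∑ i, α i), a (finSigmaFinEquiv.symm k).1 = ∏ i, a i ^ α i := by
  rw [Fintype.prod_equiv finSigmaFinEquiv.symm _ (fun p : (i : Fin n) × Fin (α i) => a p.1)
    (fun _ => rfl), Fintype.prod_sigma]
  simp

/-- By symmetry, a derivative along any tuple of basis vectors is a partial derivative `∂^α`. -/
theorem iteratedFDeriv_single_eq_multiDeriv {f : EuclideanSpace ℝ (Fin n) → ℂ}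
    (hf : ContDiff ℝ ∞ f) {l : ℕ} (c : Fin l → Fin n) (x : EuclideanSpace ℝ (Fin n)) :
    iteratedFDeriv ℝ l f x (fun k => EuclideanSpace.single (c k) (1 : ℝ)) =
      multiDeriv (multiCount c) f x := by
  have aux : ∀ (l' : ℕ) (c' : Fin l' → Fin n) (e : Fin l' ≃ Fin l), (∀ k, c (e k) = c' k) →
      iteratedFDeriv ℝ l f x (fun k => EuclideanSpace.single (c k) (1 : ℝ)) =
        iteratedFDeriv ℝ l' f x (fun k => EuclideanSpace.single (c' k) (1 : ℝ)) := by
    intro l' c' e he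
    obtain rfl : l' = l := by simpa using Fintype.card_congr e
    rw [← iteratedFDeriv_comp_perm_of_contDiff hf e]
    congr 1
    funext k
    simp [he]
  have e (i : Fin n) : Fin (multiCount c i) ≃ {k // c k = i} := (Fintype.equivFin _).symm
  exact aux _ _ (finSigmaFinEquiv.symm.trans
    ((Equiv.sigmaCongrRight e).trans (Equiv.sigmaFiberEquiv c)))
      fun k => (e (finSigmaFinEquiv.symm k).1 _).2

theorem norm_multiDeriv_le (α : Fin n → ℕ) (f : EuclideanSpace ℝ (Fin n) → ℂ)
    (x : EuclideanSpace ℝ (Fin n)) :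
    ‖multiDeriv α f x‖ ≤ ‖iteratedFDeriv ℝ (∑ i, α i) f x‖ := by
  refine (ContinuousMultilinearMap.le_opNorm _ _).trans ?_
  simp

theorem norm_continuousMultilinearMap_le_sum_single {l : ℕ} {F : Type*} [NormedAddCommGroup F]
    [NormedSpace ℝ F]
    (T : ContinuousMultilinearMap ℝ (fun _ : Fin l => EuclideanSpace ℝ (Fin n)) F) :
    ‖T‖ ≤ ∑ c : Fin l → Fin n, ‖T fun k => EuclideanSpace.single (c k) (1 : ℝ)‖ := by
  refine ContinuousMultilinearMap.opNorm_le_bound (by positivity) fun v => ?_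
  have hv : v = fun k => ∑ i, (v k i) • EuclideanSpace.single i (1 : ℝ) := by
    funext k; ext j
    simp [Finset.sum_apply, Pi.single_apply]
  conv_lhs => rw [hv, T.map_sum]
  refine (norm_sum_le _ _).trans ?_
  rw [Finset.sum_mul]
  refine Finset.sum_le_sum fun c _ => ?_
  rw [T.map_smul_univ, norm_smul, mul_comm]
  gcongr
  rw [norm_prod]
  gcongr with k
  exact PiLp.norm_apply_le (v k) (c k)

theorem norm_iteratedFDeriv_le_sum_multiDeriv {f : EuclideanSpace ℝ (Fin n) → ℂ}
    (hf : ContDiff ℝ ∞ f) (l : ℕ) (x : EuclideanSpace ℝ (Fin n)) :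
    ‖iteratedFDeriv ℝ l f x‖ ≤ ∑ c : Fin l → Fin n, ‖multiDeriv (multiCount c) f x‖ := by
  simpa only [iteratedFDeriv_single_eq_multiDeriv hf] using
    norm_continuousMultilinearMap_le_sum_single (iteratedFDeriv ℝ l f x)

theorem multiDeriv_zero (f : EuclideanSpace ℝ (Fin n) → ℂ) : multiDeriv 0 f = f := by
  have aux : ∀ (l : ℕ) (_ : l = 0) (v : Fin l → EuclideanSpace ℝ (Fin n)) x,
      iteratedFDeriv ℝ l f x v = f x := by
    rintro _ rfl v x
    simp
  funext x
  exact aux _ (by simp) _ x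

theorem multiDeriv_const_smul (α : Fin n → ℕ) {f : EuclideanSpace ℝ (Fin n) → ℂ}
    (hf : ContDiff ℝ ∞ f) (a : ℂ) (x : EuclideanSpace ℝ (Fin n)) :
    multiDeriv α (fun y => a • f y) x = a • multiDeriv α f x := by
  have : (fun y => a • f y) = a • f := rfl
  rw [multiDeriv, this, iteratedFDeriv_const_smul_apply (hf.contDiffAt.of_le (natCast_le_infty _))]; rfl

theorem multiDeriv_sum (α : Fin n → ℕ) {ι : Type*} (s : Finset ι)
    {f : ι → EuclideanSpace ℝ (Fin n) → ℂ}
    (hf : ∀ i ∈ s, ContDiff ℝ ∞ (f i)) (x : EuclideanSpace ℝ (Fin n)) :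
    multiDeriv α (fun y => ∑ i ∈ s, f i y) x = ∑ i ∈ s, multiDeriv α (f i) x := by
  rw [multiDeriv, iteratedFDeriv_sum fun i hi => (hf i hi).of_le (natCast_le_infty _)]
  simp [multiDeriv]

end MultiDeriv

/-! ### Series of smooth functions and flat functions -/

section SmoothSeries

variable {E F : Type*} [NormedAddCommGroup E] [NormedSpace ℝ E]
  [NormedAddCommGroup F] [NormedSpace ℝ F]

/-- A series of smooth functions all of whose derivatives are summable uniformly on balls may be
differentiated term by term. -/
theorem hasFTaylorSeriesUpTo_tsum_of_bound_on_ball [CompleteSpace F] {f : ℕ → E → F}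
    (hf : ∀ k, ContDiff ℝ ∞ (f k))
    (hb : ∀ (l : ℕ) (R : ℝ), ∃ u : ℕ → ℝ, Summable u ∧
      ∀ k x, ‖x‖ < R → ‖iteratedFDeriv ℝ l (f k) x‖ ≤ u k) :
    HasFTaylorSeriesUpTo ∞ (fun x => ∑' k, f k x)
      (fun x l => ∑' k, iteratedFDeriv ℝ l (f k) x) := by
  have hd (l k : ℕ) (x : E) : DifferentiableAt ℝ (iteratedFDeriv ℝ l (f k)) x :=
    ((hf k).iteratedFDeriv_right (m := ∞) (mod_cast le_top)).differentiable (by simp) x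
  have hsum (l : ℕ) (x : E) : Summable fun k => iteratedFDeriv ℝ l (f k) x := by
    obtain ⟨u, hu, hub⟩ := hb l (‖x‖ + 1)
    exact .of_norm_bounded hu fun k => hub k x (by linarith)
  have hderiv (l : ℕ) (x : E) :
      HasFDerivAt (fun y => ∑' k, iteratedFDeriv ℝ l (f k) y)
        (∑' k, iteratedFDeriv ℝ (l + 1) (f k) x).curryLeft x := by
    obtain ⟨u, hu, hub⟩ := hb (l + 1) (‖x‖ + 1)
    have h := hasFDerivAt_tsum_of_isPreconnected (f := fun k => iteratedFDeriv ℝ l (f k))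
      (f' := fun k => fderiv ℝ (iteratedFDeriv ℝ l (f k))) (s := Metric.ball (0 : E) (‖x‖ + 1))
      hu Metric.isOpen_ball (convex_ball _ _).isPreconnected
      (fun k y _ => (hd l k y).hasFDerivAt)
      (fun k y hy => by
        rw [fderiv_iteratedFDeriv, Function.comp_apply, LinearIsometryEquiv.norm_map]
        exact hub k y (by simpa using hy))
      (Metric.mem_ball_self (by positivity)) (hsum l 0) (x := x) (by simp)
    convert! h using 1
    simp only [fderiv_iteratedFDeriv, Function.comp_apply]
    exact (continuousMultilinearCurryLeftEquiv ℝ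
      (fun _ : Fin (l + 1) => E) F).toContinuousLinearEquiv.map_tsum
  refine ⟨fun x => ?_, fun l _ x => hderiv l x, fun l _ => ?_⟩
  · have := (continuousMultilinearCurryFin0 ℝ E F).toContinuousLinearEquiv.map_tsum
      (f := fun k => iteratedFDeriv ℝ 0 (f k) x) (L := .unconditional ℕ)
    simpa using this
  · exact continuous_iff_continuousAt.2 fun x => (hderiv l x).continuousAt

/-- Taylor's inequality for a function that is flat at the origin. -/
theorem norm_iteratedFDeriv_le_mul_pow_of_flat {f : E → F} (hf : ContDiff ℝ ∞ f)
    (h0 : ∀ l, iteratedFDeriv ℝ l f 0 = 0) {A : ℝ} (M l : ℕ)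
    (hA : ∀ y, ‖iteratedFDeriv ℝ (l + M) f y‖ ≤ A) (x : E) :
    ‖iteratedFDeriv ℝ l f x‖ ≤ A * ‖x‖ ^ M := by
  induction M generalizing l x with
  | zero => simpa using hA x
  | succ M ih =>
    have hA0 : 0 ≤ A := (norm_nonneg _).trans (hA 0)
    have h := (convex_closedBall (0 : E) ‖x‖).norm_image_sub_le_of_norm_fderiv_le
      (f := iteratedFDeriv ℝ l f) (C := A * ‖x‖ ^ M) (𝕜 := ℝ) (x := 0) (y := x)
      (fun y _ => (hf.iteratedFDeriv_right (m := ∞) (mod_cast le_top)).differentiable (by simp) y)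
      (fun y hy => by
        rw [fderiv_iteratedFDeriv, Function.comp_apply, LinearIsometryEquiv.norm_map]
        refine (ih (l + 1) (by rwa [add_right_comm]) y).trans ?_
        gcongr
        simpa using hy)
      (by simp) (by simp)
    rw [h0, sub_zero, sub_zero] at h
    rwa [pow_succ, ← mul_assoc]

theorem SchwartzMap.exists_hasSum_of_summable_seminorm [CompleteSpace F]
    {f : ℕ → 𝓢(E, F)} (hf : ∀ p l, Summable fun k => SchwartzMap.seminorm ℝ p l (f k)) :
    ∃ g : 𝓢(E, F), HasSum f g := by
  have hb (p l k : ℕ) (x : E) : ‖x‖ ^ p * ‖iteratedFDeriv ℝ l (f k) x‖ ≤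
      SchwartzMap.seminorm ℝ p l (f k) := SchwartzMap.le_seminorm ℝ p l (f k) x
  have hT := hasFTaylorSeriesUpTo_tsum_of_bound_on_ball (fun k => (f k).smooth ⊤)
    fun l _ => ⟨_, hf 0 l, fun k x _ => by simpa using hb 0 l k x⟩
  have hder (l : ℕ) (x : E) : iteratedFDeriv ℝ l (fun x => ∑' k, f k x) x =
      ∑' k, iteratedFDeriv ℝ l (f k) x :=
    (hT.eq_iteratedFDeriv (mod_cast le_top) x).symm
  have hsum (l : ℕ) (x : E) : Summable fun k => iteratedFDeriv ℝ l (f k) x :=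
    .of_norm_bounded (hf 0 l) fun k => by simpa using hb 0 l k x
  -- the weighted tail of the series of derivatives, outside an arbitrary finite set
  have htail (p l : ℕ) (s : Finset ℕ) (x : E) :
      ‖x‖ ^ p * ‖∑' k, iteratedFDeriv ℝ l (f k) x - ∑ k ∈ s, iteratedFDeriv ℝ l (f k) x‖ ≤
        ∑' k, SchwartzMap.seminorm ℝ p l (f k) - ∑ k ∈ s, SchwartzMap.seminorm ℝ p l (f k) := by
    rw [← (hsum l x).sum_add_tsum_compl (s := s), ← (hf p l).sum_add_tsum_compl (s := s),
      add_sub_cancel_left, add_sub_cancel_left]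
    have hs : Summable fun k : ↥((s : Set ℕ)ᶜ) => SchwartzMap.seminorm ℝ p l (f k) :=
      (hf p l).subtype _
    have hn : Summable fun k : ↥((s : Set ℕ)ᶜ) => ‖iteratedFDeriv ℝ l (f k) x‖ := by
      refine Summable.subtype (f := fun k => ‖iteratedFDeriv ℝ l (f k) x‖) ?_ _
      exact .of_nonneg_of_le (fun _ => norm_nonneg _) (fun k => by simpa using hb 0 l k x) (hf 0 l)
    calc _ ≤ ‖x‖ ^ p * ∑' k : ↥((s : Set ℕ)ᶜ), ‖iteratedFDeriv ℝ l (f k) x‖ := by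
          gcongr; exact norm_tsum_le_tsum_norm hn
      _ = ∑' k : ↥((s : Set ℕ)ᶜ), ‖x‖ ^ p * ‖iteratedFDeriv ℝ l (f k) x‖ := tsum_mul_left.symm
      _ ≤ _ := (hn.mul_left _).tsum_le_tsum (fun k => hb p l k x) hs
  let g : 𝓢(E, F) :=
    { toFun := fun x => ∑' k, f k x
      smooth' := hT.contDiff
      decay' := fun p l => ⟨∑' k, SchwartzMap.seminorm ℝ p l (f k), fun x => by
        rw [hder]
        simpa using htail p l ∅ x⟩ }
  refine ⟨g, ((schwartz_withSeminorms ℝ E F).tendsto_nhds _ _).2 fun ⟨p, l⟩ ε hε => ?_⟩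
  have hlim := (hf p l).hasSum
  rw [HasSum, tendsto_order] at hlim
  filter_upwards [hlim.1 (∑' k, SchwartzMap.seminorm ℝ p l (f k) - ε) (by linarith)] with s hs
  refine lt_of_le_of_lt (SchwartzMap.seminorm_le_bound ℝ p l _ ?_ fun x => ?_)
    (show ∑' k, SchwartzMap.seminorm ℝ p l (f k) - ∑ k ∈ s, SchwartzMap.seminorm ℝ p l (f k) < ε
      by linarith)
  · have := (hf p l).sum_le_tsum s fun k _ => apply_nonneg _ _
    linarith
  · have e : iteratedFDeriv ℝ l (∑ k ∈ s, f k - g : 𝓢(E, F)) x =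
        -(∑' k, iteratedFDeriv ℝ l (f k) x - ∑ k ∈ s, iteratedFDeriv ℝ l (f k) x) := by
      have e1 : ((∑ k ∈ s, f k - g : 𝓢(E, F)) : E → F) = (fun x => ∑ k ∈ s, f k x) - g := by
        ext y; simp
      have hsm : ContDiff ℝ ∞ fun x => ∑ k ∈ s, f k x :=
        ContDiff.sum fun k _ => (f k).smooth ⊤
      rw [e1, iteratedFDeriv_sub_apply (hsm.contDiffAt.of_le (natCast_le_infty l))
        ((g.smooth ⊤).contDiffAt.of_le (natCast_le_infty l)),
        iteratedFDeriv_sum fun k _ => ((f k).smooth ⊤).of_le (natCast_le_infty l), neg_sub]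
      exact congrArg₂ _ (Finset.sum_apply _ _ _) (hder l x)
    rw [e, norm_neg]
    exact htail p l s x

end SmoothSeries

/-! ### The norms of the Schwartz space -/

section SchwartzNorm

variable {n : ℕ}

theorem schwartzNorm_nonneg (N : ℕ) (f : 𝓢(EuclideanSpace ℝ (Fin n), ℂ)) : 0 ≤ schwartzNorm N f :=
  apply_nonneg _ _

theorem seminorm_le_schwartzNorm {N p l : ℕ} (hp : p ≤ N) (hl : l ≤ N)
    (f : 𝓢(EuclideanSpace ℝ (Fin n), ℂ)) :
    SchwartzMap.seminorm ℂ p l f ≤ schwartzNorm N f :=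
  Seminorm.le_def.1 (Finset.le_sup (f := schwartzSeminormFamily ℂ (EuclideanSpace ℝ (Fin n)) ℂ)
    (b := (p, l)) (Finset.mem_Iic.2 (Prod.mk_le_mk.2 ⟨hp, hl⟩))) f

theorem pow_mul_norm_iteratedFDeriv_le_schwartzNorm {N p l : ℕ} (hp : p ≤ N) (hl : l ≤ N)
    (f : 𝓢(EuclideanSpace ℝ (Fin n), ℂ)) (x : EuclideanSpace ℝ (Fin n)) :
    ‖x‖ ^ p * ‖iteratedFDeriv ℝ l f x‖ ≤ schwartzNorm N f :=
  (SchwartzMap.le_seminorm ℂ p l f x).trans (seminorm_le_schwartzNorm hp hl f)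

theorem one_add_pow_mul_norm_iteratedFDeriv_le_schwartzNorm {N p l : ℕ} (hp : p ≤ N) (hl : l ≤ N)
    (f : 𝓢(EuclideanSpace ℝ (Fin n), ℂ)) (x : EuclideanSpace ℝ (Fin n)) :
    (1 + ‖x‖) ^ p * ‖iteratedFDeriv ℝ l f x‖ ≤ 2 ^ N * schwartzNorm N f :=
  SchwartzMap.one_add_le_sup_seminorm_apply (𝕜 := ℂ) (m := (N, N)) hp hl f x

theorem schwartzNorm_mono {N M : ℕ} (h : N ≤ M) (f : 𝓢(EuclideanSpace ℝ (Fin n), ℂ)) :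
    schwartzNorm N f ≤ schwartzNorm M f :=
  Seminorm.le_def.1 (Finset.sup_mono (Finset.Iic_subset_Iic.2 (Prod.mk_le_mk.2 ⟨h, h⟩))) f

theorem schwartzNorm_smul (N : ℕ) (c : ℂ) (f : 𝓢(EuclideanSpace ℝ (Fin n), ℂ)) :
    schwartzNorm N (c • f) = ‖c‖ * schwartzNorm N f :=
  map_smul_eq_mul _ _ _

theorem isVonNBounded_range_iff_schwartzNorm {φ : ℕ → 𝓢(EuclideanSpace ℝ (Fin n), ℂ)} :
    Bornology.IsVonNBounded ℂ (Set.range φ) ↔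
      ∀ N, ∃ B, 0 ≤ B ∧ ∀ k, schwartzNorm N (φ k) ≤ B := by
  rw [(schwartz_withSeminorms ℂ (EuclideanSpace ℝ (Fin n)) ℂ).isVonNBounded_iff_seminorm_bounded]
  constructor
  · intro h N
    choose r hr0 hr using h
    refine ⟨∑ i ∈ Finset.Iic (N, N), r i, Finset.sum_nonneg fun i _ => (hr0 i).le, fun k => ?_⟩
    refine Seminorm.finset_sup_apply_le (Finset.sum_nonneg fun i _ => (hr0 i).le) fun i hi => ?_
    exact (hr i _ (Set.mem_range_self k)).le.trans
      (Finset.single_le_sum (f := r) (fun i _ => (hr0 i).le) hi)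
  · rintro h ⟨p, l⟩
    obtain ⟨B, hB0, hB⟩ := h (max p l)
    refine ⟨B + 1, by positivity, ?_⟩
    rintro _ ⟨k, rfl⟩
    have := (seminorm_le_schwartzNorm (le_max_left p l) (le_max_right p l) (φ k)).trans (hB k)
    exact lt_of_le_of_lt this (lt_add_one B)

end SchwartzNorm

/-! ### Dilations and homogeneous norms -/

section EuclideanNorm

variable {n : ℕ}

theorem EuclideanSpace.norm_le_norm_of_abs_le {x y : EuclideanSpace ℝ (Fin n)}
    (h : ∀ i, |x i| ≤ |y i|) : ‖x‖ ≤ ‖y‖ := by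
  rw [EuclideanSpace.norm_eq, EuclideanSpace.norm_eq]
  gcongr with i
  exact h i

theorem EuclideanSpace.norm_le_sum_abs (x : EuclideanSpace ℝ (Fin n)) : ‖x‖ ≤ ∑ i, |x i| := by
  have hx : x = ∑ i, x i • EuclideanSpace.single i (1 : ℝ) := by
    ext j
    simp [Finset.sum_apply, Pi.single_apply]
  conv_lhs => rw [hx]
  refine (norm_sum_le _ _).trans (le_of_eq ?_)
  simp [norm_smul]

end EuclideanNorm

namespace HomogeneousGroup

variable {n : ℕ} [NeZero n] (G : HomogeneousGroup n)

theorem weight_pos (i : Fin n) : 0 < G.weight i := one_pos.trans_le (G.one_le_weight i)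

theorem weight_le_homDim (i : Fin n) : G.weight i ≤ G.homDim :=
  Finset.single_le_sum (f := G.weight) (fun k _ => (G.weight_pos k).le) (Finset.mem_univ i)

theorem dyadicComp_apply (k : ℤ) (f : 𝓢(EuclideanSpace ℝ (Fin n), ℂ))
    (x : EuclideanSpace ℝ (Fin n)) :
    G.dyadicComp k f x = f (G.dilation ((2 : ℝ) ^ k) (by positivity) x) := rfl

theorem dilation_dilation {r s : ℝ} (hr : 0 < r) (hs : 0 < s) (x : EuclideanSpace ℝ (Fin n)) :
    G.dilation r hr (G.dilation s hs x) = G.dilation (r * s) (mul_pos hr hs) x := by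
  ext i
  simp only [dilation_apply, Real.mul_rpow hr.le hs.le, mul_assoc]

theorem dilation_dilation_of_mul_eq_one {r s : ℝ} (hr : 0 < r) (hs : 0 < s) (h : r * s = 1)
    (x : EuclideanSpace ℝ (Fin n)) : G.dilation r hr (G.dilation s hs x) = x := by
  ext i
  rw [dilation_dilation, dilation_apply, h, Real.one_rpow, one_mul]

theorem dilation_single {r : ℝ} (hr : 0 < r) (i : Fin n) :
    G.dilation r hr (EuclideanSpace.single i (1 : ℝ)) =
      (r ^ G.weight i) • EuclideanSpace.single i (1 : ℝ) := by
  ext k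
  rw [dilation_apply]
  by_cases h : k = i
  · subst h; simp
  · simp [h]

theorem mul_norm_le_norm_dilation {r : ℝ} (hr : 1 ≤ r) (x : EuclideanSpace ℝ (Fin n)) :
    r * ‖x‖ ≤ ‖G.dilation r (one_pos.trans_le hr) x‖ := by
  have hr0 : 0 < r := one_pos.trans_le hr
  have e : r * ‖x‖ = ‖r • x‖ := by rw [norm_smul, Real.norm_of_nonneg hr0.le]
  rw [e]
  refine EuclideanSpace.norm_le_norm_of_abs_le fun i => ?_
  rw [dilation_apply, PiLp.smul_apply, smul_eq_mul, abs_mul, abs_mul, abs_of_pos hr0,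
    abs_of_pos (Real.rpow_pos_of_pos hr0 _)]
  gcongr
  exact Real.self_le_rpow_of_one_le hr (G.one_le_weight i)

theorem norm_dilation_le {r : ℝ} (hr : 1 ≤ r) :
    ‖(G.dilation r (one_pos.trans_le hr) :
      EuclideanSpace ℝ (Fin n) →L[ℝ] EuclideanSpace ℝ (Fin n))‖ ≤ r ^ G.homDim := by
  have hr0 : 0 < r := one_pos.trans_le hr
  have hQ : 0 < r ^ G.homDim := Real.rpow_pos_of_pos hr0 _
  refine ContinuousLinearMap.opNorm_le_bound _ hQ.le fun x => ?_
  have e : r ^ G.homDim * ‖x‖ = ‖r ^ G.homDim • x‖ := by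
    rw [norm_smul, Real.norm_of_nonneg hQ.le]
  rw [e]
  refine EuclideanSpace.norm_le_norm_of_abs_le fun i => ?_
  rw [ContinuousLinearEquiv.coe_coe, dilation_apply, PiLp.smul_apply, smul_eq_mul, abs_mul,
    abs_mul, abs_of_pos hQ, abs_of_pos (Real.rpow_pos_of_pos hr0 _)]
  gcongr
  exact G.weight_le_homDim i

theorem weightedLength_nonneg (α : Fin n → ℕ) : 0 ≤ G.weightedLength α :=
  Finset.sum_nonneg fun i _ => mul_nonneg (G.weight_pos i).le (Nat.cast_nonneg _)

theorem multiDeriv_comp_dilation (α : Fin n → ℕ) {f : EuclideanSpace ℝ (Fin n) → ℂ}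
    (hf : ContDiff ℝ ∞ f) {r : ℝ} (hr : 0 < r) (x : EuclideanSpace ℝ (Fin n)) :
    multiDeriv α (fun y => f (G.dilation r hr y)) x =
      (r ^ G.weightedLength α : ℝ) • multiDeriv α f (G.dilation r hr x) := by
  have h := (G.dilation r hr : EuclideanSpace ℝ (Fin n) →L[ℝ] _).iteratedFDeriv_comp_right hf x
    (natCast_le_infty (∑ i, α i))
  have e : (fun y => f (G.dilation r hr y)) =
    f ∘ (G.dilation r hr : EuclideanSpace ℝ (Fin n) →L[ℝ] EuclideanSpace ℝ (Fin n)) := rfl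
  rw [multiDeriv, e, h, ContinuousMultilinearMap.compContinuousLinearMap_apply]
  simp only [ContinuousLinearEquiv.coe_coe, dilation_single]
  rw [ContinuousMultilinearMap.map_smul_univ,
    prod_finSigmaFinEquiv_symm_eq_prod_pow α (fun i => r ^ G.weight i)]
  congr 1
  simp_rw [← Real.rpow_natCast, ← Real.rpow_mul hr.le]
  exact (Real.rpow_sum_of_pos hr _ _).symm

theorem multTerm_apply (j : ℝ) (ψ : ℕ → 𝓢(EuclideanSpace ℝ (Fin n), ℂ)) (k : ℕ)
    (x : EuclideanSpace ℝ (Fin n)) :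
    G.multTerm j ψ k x =
      (2 : ℝ) ^ (j * k) • ψ k (G.dilation ((2 : ℝ) ^ (-(k : ℤ))) (by positivity) x) := by
  simp [multTerm, dyadicComp_apply]

theorem two_zpow_neg_eq_rpow (k : ℕ) : (2 : ℝ) ^ (-(k : ℤ)) = (2 : ℝ) ^ (-(k : ℝ)) := by
  rw [← Real.rpow_intCast]; push_cast; rfl

theorem multiDeriv_multTerm (α : Fin n → ℕ) (j : ℝ) (ψ : ℕ → 𝓢(EuclideanSpace ℝ (Fin n), ℂ))
    (k : ℕ) (x : EuclideanSpace ℝ (Fin n)) :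
    multiDeriv α (G.multTerm j ψ k) x = ((2 : ℝ) ^ ((j - G.weightedLength α) * k)) •
      multiDeriv α (ψ k) (G.dilation ((2 : ℝ) ^ (-(k : ℤ))) (by positivity) x) := by
  have hs : ContDiff ℝ ∞ (ψ k) := (ψ k).smooth ⊤
  have hc : ContDiff ℝ ∞ fun y => ψ k (G.dilation ((2 : ℝ) ^ (-(k : ℤ))) (by positivity) y) :=
    hs.comp (G.dilation _ _).contDiff
  have e : (G.multTerm j ψ k : EuclideanSpace ℝ (Fin n) → ℂ) = fun y =>
      (((2 : ℝ) ^ (j * k) : ℝ) : ℂ) •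
        ψ k (G.dilation ((2 : ℝ) ^ (-(k : ℤ))) (by positivity) y) := rfl
  rw [e, multiDeriv_const_smul α hc, G.multiDeriv_comp_dilation α hs, Complex.coe_smul,
    smul_smul]
  congr 1
  rw [two_zpow_neg_eq_rpow, ← Real.rpow_mul zero_le_two, ← Real.rpow_add two_pos]
  congr 1
  ring

variable {G}

namespace HomogeneousNorm

variable (ν : G.HomogeneousNorm)

theorem map_zero : ν.toFun 0 = 0 := (ν.eq_zero_iff 0).2 G.one_eq_zero.symm

theorem pos_of_ne_zero {x : EuclideanSpace ℝ (Fin n)} (hx : x ≠ 0) : 0 < ν.toFun x :=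
  (ν.nonneg x).lt_of_ne fun h => hx (((ν.eq_zero_iff x).1 h.symm).trans G.one_eq_zero)

theorem exists_bounds_on_annulus {r : ℝ} (hr : 0 < r) (R : ℝ) :
    ∃ c C : ℝ, 0 < c ∧ 0 < C ∧ ∀ x, r ≤ ‖x‖ → ‖x‖ ≤ R → c ≤ ν.toFun x ∧ ν.toFun x ≤ C := by
  have hK : IsCompact (Metric.closedBall (0 : EuclideanSpace ℝ (Fin n)) R \ Metric.ball 0 r) :=
    (isCompact_closedBall _ _).diff Metric.isOpen_ball
  rcases (Metric.closedBall (0 : EuclideanSpace ℝ (Fin n)) R \ Metric.ball 0 r).eq_empty_or_nonempty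
    with he | hne
  · refine ⟨1, 1, one_pos, one_pos, fun x h1 h2 => ?_⟩
    have : x ∈ Metric.closedBall (0 : EuclideanSpace ℝ (Fin n)) R \ Metric.ball 0 r := by
      simp [h1, h2]
    rw [he] at this
    exact this.elim
  · obtain ⟨x, hx, hmin⟩ := hK.exists_isMinOn hne ν.continuous.continuousOn
    obtain ⟨y, hy, hmax⟩ := hK.exists_isMaxOn hne ν.continuous.continuousOn
    have h0 {z : EuclideanSpace ℝ (Fin n)}
        (hz : z ∈ Metric.closedBall (0 : EuclideanSpace ℝ (Fin n)) R \ Metric.ball 0 r) :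
        0 < ν.toFun z := by
      refine ν.pos_of_ne_zero ?_
      rintro rfl
      simp [hr] at hz
    refine ⟨ν.toFun x, ν.toFun y, h0 hx, h0 hy, fun z h1 h2 => ?_⟩
    have hz : z ∈ Metric.closedBall (0 : EuclideanSpace ℝ (Fin n)) R \ Metric.ball 0 r := by
      simp [h1, h2]
    exact ⟨hmin hz, hmax hz⟩

end HomogeneousNorm

/-- Polar decomposition: a nonzero point is a dilate, by the factor `max |xᵢ| ^ (1 / aᵢ)`, of a
point of the boundary of the unit cube. -/
theorem exists_eq_dilation {x : EuclideanSpace ℝ (Fin n)} (hx : x ≠ 0) :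
    ∃ (R : ℝ) (hR : 0 < R) (θ : EuclideanSpace ℝ (Fin n)), x = G.dilation R hR θ ∧
      (∀ i, |θ i| ≤ 1) ∧ 1 ≤ ‖θ‖ ∧ R ≤ 1 + ‖x‖ := by
  obtain ⟨i₀, -, hi₀⟩ := Finset.exists_max_image Finset.univ
    (fun i => |x i| ^ (G.weight i)⁻¹) Finset.univ_nonempty
  set R := |x i₀| ^ (G.weight i₀)⁻¹ with hRdef
  have hpow (i : Fin n) : (|x i| ^ (G.weight i)⁻¹) ^ G.weight i = |x i| := by
    rw [← Real.rpow_mul (abs_nonneg _), inv_mul_cancel₀ (G.weight_pos i).ne', Real.rpow_one]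
  have hR : 0 < R := by
    by_contra! hle
    refine hx ?_
    ext i
    have h1 : |x i| ^ (G.weight i)⁻¹ = 0 :=
      le_antisymm ((hi₀ i (Finset.mem_univ i)).trans hle) (Real.rpow_nonneg (abs_nonneg _) _)
    have h2 := hpow i
    rw [h1, Real.zero_rpow (G.weight_pos i).ne'] at h2
    simpa using h2.symm
  have hle (i : Fin n) : |x i| ≤ R ^ G.weight i := by
    rw [← hpow i]
    exact Real.rpow_le_rpow (Real.rpow_nonneg (abs_nonneg _) _) (hi₀ i (Finset.mem_univ i))
      (G.weight_pos i).le
  have hθ (i : Fin n) : |(G.dilation R hR).symm x i| = (R ^ G.weight i)⁻¹ * |x i| := by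
    have : (G.dilation R hR).symm x i = (R ^ G.weight i)⁻¹ * x i := rfl
    rw [this, abs_mul, abs_of_pos (inv_pos.2 (Real.rpow_pos_of_pos hR _))]
  refine ⟨R, hR, (G.dilation R hR).symm x, by simp, fun i => ?_, ?_, ?_⟩
  · rw [hθ, inv_mul_le_one₀ (Real.rpow_pos_of_pos hR _)]
    exact hle i
  · refine le_trans (le_of_eq ?_) (PiLp.norm_apply_le _ i₀)
    have h1 : R ^ G.weight i₀ = |x i₀| := hpow i₀
    rw [Real.norm_eq_abs, hθ, h1, inv_mul_cancel₀]
    rw [← h1]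
    exact (Real.rpow_pos_of_pos hR _).ne'
  · have h1 : |x i₀| ≤ 1 + ‖x‖ := by
      have := PiLp.norm_apply_le x i₀
      rw [Real.norm_eq_abs] at this
      linarith
    calc R ≤ (1 + ‖x‖) ^ (G.weight i₀)⁻¹ :=
          Real.rpow_le_rpow (abs_nonneg _) h1 (inv_nonneg.2 (G.weight_pos i₀).le)
      _ ≤ (1 + ‖x‖) ^ (1 : ℝ) := Real.rpow_le_rpow_of_exponent_le
          (by linarith [norm_nonneg x]) (inv_le_one_of_one_le₀ (G.one_le_weight i₀))
      _ = _ := Real.rpow_one _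

namespace HomogeneousNorm

variable (ν : G.HomogeneousNorm)

/-- Comparison of a homogeneous norm with the Euclidean one: `|x|` is at most of order `‖x‖` at
infinity, and `‖x‖` is at most of order `|x|` at the origin, since all weights are at least `1`. -/
theorem exists_comparison : ∃ A : ℝ, 1 ≤ A ∧ (∀ x, 1 + ν.toFun x ≤ A * (1 + ‖x‖)) ∧
    ∀ x, ν.toFun x ≤ 1 → ‖x‖ ≤ A * ν.toFun x := by
  obtain ⟨c, C, hc, hC, hcC⟩ := ν.exists_bounds_on_annulus one_pos (n : ℝ)
  set D : ℝ := ∑ i, (c ^ G.weight i)⁻¹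
  have hD : 0 ≤ D := Finset.sum_nonneg fun i _ => (inv_pos.2 (Real.rpow_pos_of_pos hc _)).le
  have hpolar (x : EuclideanSpace ℝ (Fin n)) (hx : x ≠ 0) : ∃ R : ℝ, 0 < R ∧
      c * R ≤ ν.toFun x ∧ ν.toFun x ≤ C * R ∧ R ≤ 1 + ‖x‖ ∧ ∀ i, |x i| ≤ R ^ G.weight i := by
    obtain ⟨R, hR, θ, rfl, h1, h2, h3⟩ := exists_eq_dilation (G := G) hx
    have hn : ‖θ‖ ≤ n := by
      refine (EuclideanSpace.norm_le_sum_abs θ).trans ((Finset.sum_le_sum fun i _ => h1 i).trans ?_)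
      simp
    obtain ⟨h4, h5⟩ := hcC θ h2 hn
    refine ⟨R, hR, ?_, ?_, h3, fun i => ?_⟩
    · rw [ν.map_dilation, mul_comm]; gcongr
    · rw [ν.map_dilation, mul_comm]; gcongr
    · rw [dilation_apply, abs_mul, abs_of_pos (Real.rpow_pos_of_pos hR _)]
      exact mul_le_of_le_one_right (Real.rpow_pos_of_pos hR _).le (h1 i)
  refine ⟨1 + C + D, by linarith, fun x => ?_, fun x hx1 => ?_⟩
  · rcases eq_or_ne x 0 with rfl | hx
    · rw [ν.map_zero, norm_zero]; linarith
    · obtain ⟨R, hR, -, h1, h2, -⟩ := hpolar x hx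
      have h3 : C * R ≤ C * (1 + ‖x‖) := by gcongr
      nlinarith [norm_nonneg x, mul_nonneg hD (norm_nonneg x)]
  · rcases eq_or_ne x 0 with rfl | hx
    · simp [ν.map_zero]
    · obtain ⟨R, hR, h1, -, -, h2⟩ := hpolar x hx
      have hν := ν.nonneg x
      have h3 : ‖x‖ ≤ D * ν.toFun x := by
        refine (EuclideanSpace.norm_le_sum_abs x).trans ?_
        rw [Finset.sum_mul]
        refine Finset.sum_le_sum fun i _ => (h2 i).trans ?_
        rw [inv_mul_eq_div, le_div_iff₀ (Real.rpow_pos_of_pos hc _), mul_comm,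
          ← Real.mul_rpow hc.le hR.le]
        refine (Real.rpow_le_rpow (by positivity) h1 (G.weight_pos i).le).trans ?_
        exact Real.rpow_le_self_of_le_one hν hx1 (G.one_le_weight i)
      nlinarith

end HomogeneousNorm

end HomogeneousGroup

/-! ### Moments, dilations and the Fourier transform -/

section Moments

variable {n : ℕ}

/-- The derivatives at the origin of a Fourier transform are multiples of the moments. -/
theorem iteratedFDeriv_fourier_zero_apply (f : 𝓢(EuclideanSpace ℝ (Fin n), ℂ)) {l : ℕ}
    (c : Fin l → Fin n) :
    iteratedFDeriv ℝ l (𝓕 f : 𝓢(EuclideanSpace ℝ (Fin n), ℂ)) 0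
        (fun k => EuclideanSpace.single (c k) (1 : ℝ)) =
      (-(2 * Real.pi * Complex.I)) ^ l * ∫ x, (∏ k, ((x (c k) : ℝ) : ℂ)) * f x := by
  have hint (m : ℕ) : Integrable fun v => ‖v‖ ^ m * ‖f v‖ := f.integrable_pow_mul volume m
  have h := congrFun (Real.iteratedFDeriv_fourier (N := ⊤) (fun m _ => hint m)
    f.integrable.aestronglyMeasurable (n := l) (mod_cast le_top)) 0
  rw [SchwartzMap.fourier_coe, h, Real.fourier_eq]
  simp only [inner_zero_right, neg_zero, AddChar.map_zero_eq_one, one_smul]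
  rw [ContinuousMultilinearMap.integral_apply
    (VectorFourier.integrable_fourierPowSMulRight _ (hint l) f.integrable.aestronglyMeasurable),
    ← integral_const_mul]
  refine integral_congr_ae (Eventually.of_forall fun x => ?_)
  have e (k : Fin l) : innerSL ℝ x (EuclideanSpace.single (c k) (1 : ℝ)) = x (c k) := by
    rw [innerSL_apply_apply, EuclideanSpace.inner_single_right]
    simp
  simp [VectorFourier.fourierPowSMulRight_apply, e]

/-- A Schwartz function is the Fourier transform of one with vanishing moments if and only if it is
flat at the origin. -/
theorem mem_schwartzZeroMomentsHat_iff {ψ : 𝓢(EuclideanSpace ℝ (Fin n), ℂ)} :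
    ψ ∈ schwartzZeroMomentsHat n ↔ ∀ l, iteratedFDeriv ℝ l ψ 0 = 0 := by
  constructor
  · rintro ⟨f, hf, rfl⟩ l
    rw [← norm_le_zero_iff]
    refine (norm_continuousMultilinearMap_le_sum_single _).trans (le_of_eq ?_)
    refine Finset.sum_eq_zero fun c _ => ?_
    have h := hf (multiCount c)
    simp only [← prod_comp_eq_prod_pow_multiCount] at h
    simp only [iteratedFDeriv_fourier_zero_apply]
    rw [h, mul_zero, norm_zero]
  · intro h
    refine ⟨𝓕⁻ ψ, fun α => ?_, FourierTransform.fourier_fourierInv_eq ψ⟩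
    have h1 := iteratedFDeriv_fourier_zero_apply (𝓕⁻ ψ) (l := ∑ i, α i)
      (fun k => (finSigmaFinEquiv.symm k).1)
    rw [FourierTransform.fourier_fourierInv_eq, h] at h1
    have h2 : (-(2 * Real.pi * Complex.I)) ^ (∑ i, α i) ≠ 0 :=
      pow_ne_zero _ (neg_ne_zero.2 Complex.two_pi_I_ne_zero)
    have h3 := (mul_eq_zero.1 h1.symm).resolve_left h2
    convert! h3 using 4 with x
    exact (prod_finSigmaFinEquiv_symm_eq_prod_pow α fun i => ((x i : ℝ) : ℂ)).symm

theorem fourier_mem_schwartzZeroMomentsHat {φ : 𝓢(EuclideanSpace ℝ (Fin n), ℂ)}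
    (hφ : φ ∈ schwartzZeroMoments n) : 𝓕 φ ∈ schwartzZeroMomentsHat n := ⟨φ, hφ, rfl⟩

theorem fourierInv_mem_schwartzZeroMoments {ψ : 𝓢(EuclideanSpace ℝ (Fin n), ℂ)}
    (hψ : ψ ∈ schwartzZeroMomentsHat n) : 𝓕⁻ ψ ∈ schwartzZeroMoments n := by
  obtain ⟨φ, hφ, rfl⟩ := hψ
  simpa using hφ

theorem IsBoundedSeqIn.fourier {φ : ℕ → 𝓢(EuclideanSpace ℝ (Fin n), ℂ)}
    (hφ : IsBoundedSeqIn (schwartzZeroMoments n) φ) :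
    IsBoundedSeqIn (schwartzZeroMomentsHat n) fun k => 𝓕 (φ k) := by
  refine ⟨?_, fun k hk => fourier_mem_schwartzZeroMomentsHat (hφ.2 k hk)⟩
  have := hφ.1.image (FourierTransform.fourierCLM ℂ 𝓢(EuclideanSpace ℝ (Fin n), ℂ))
  rwa [← Set.range_comp] at this

theorem IsBoundedSeqIn.fourierInv {ψ : ℕ → 𝓢(EuclideanSpace ℝ (Fin n), ℂ)}
    (hψ : IsBoundedSeqIn (schwartzZeroMomentsHat n) ψ) :
    IsBoundedSeqIn (schwartzZeroMoments n) fun k => 𝓕⁻ (ψ k) := by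
  refine ⟨?_, fun k hk => fourierInv_mem_schwartzZeroMoments (hψ.2 k hk)⟩
  have := hψ.1.image (FourierTransform.fourierInvCLM ℂ 𝓢(EuclideanSpace ℝ (Fin n), ℂ))
  rwa [← Set.range_comp] at this

theorem schwartzToDist_fourierInv (f : 𝓢(EuclideanSpace ℝ (Fin n), ℂ)) :
    schwartzToDist (𝓕⁻ f) = 𝓕⁻ (schwartzToDist f) :=
  (TemperedDistribution.fourierInv_toTemperedDistributionCLM_eq f).symm

end Moments

namespace HomogeneousGroup

variable {n : ℕ} [NeZero n] (G : HomogeneousGroup n)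

theorem det_dilation {r : ℝ} (hr : 0 < r) :
    LinearMap.det ((G.dilation r hr).toLinearEquiv :
      EuclideanSpace ℝ (Fin n) →ₗ[ℝ] EuclideanSpace ℝ (Fin n)) = r ^ G.homDim := by
  set b := (EuclideanSpace.basisFun (Fin n) ℝ).toBasis
  have h : ((G.dilation r hr).toLinearEquiv :
      EuclideanSpace ℝ (Fin n) →ₗ[ℝ] EuclideanSpace ℝ (Fin n)) =
      Matrix.toLin b b (Matrix.diagonal fun i => r ^ G.weight i) := by
    refine b.ext fun i => ?_
    rw [Matrix.toLin_self, Finset.sum_eq_single i]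
    · simpa [b] using G.dilation_single hr i
    · intro k _ hk
      rw [Matrix.diagonal_apply_ne _ hk, zero_smul]
    · simp
  rw [h, LinearMap.det_toLin, Matrix.det_diagonal]
  exact (Real.rpow_sum_of_pos hr _ _).symm

theorem integral_comp_dilation {r : ℝ} (hr : 0 < r) (f : EuclideanSpace ℝ (Fin n) → ℂ) :
    ∫ x, f x = (r ^ G.homDim : ℝ) • ∫ x, f (G.dilation r hr x) := by
  have hQ : 0 < r ^ G.homDim := Real.rpow_pos_of_pos hr _
  have hdet := G.det_dilation hr
  have hmap := Measure.map_linearMap_addHaar_eq_smul_addHaar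
    (volume : Measure (EuclideanSpace ℝ (Fin n))) (f :=
      ((G.dilation r hr).toLinearEquiv :
        EuclideanSpace ℝ (Fin n) →ₗ[ℝ] EuclideanSpace ℝ (Fin n))) (by rw [hdet]; exact hQ.ne')
  rw [hdet] at hmap
  have h := (G.dilation r hr).toHomeomorph.measurableEmbedding.integral_map
    (μ := volume) (g := f)
  have e : Measure.map (G.dilation r hr).toHomeomorph volume =
    Measure.map ((G.dilation r hr).toLinearEquiv :
        EuclideanSpace ℝ (Fin n) →ₗ[ℝ] EuclideanSpace ℝ (Fin n)) volume := rfl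
  rw [e, hmap, integral_smul_measure, ENNReal.toReal_ofReal (abs_nonneg _),
    abs_of_pos (inv_pos.2 hQ)] at h
  have h' : ∫ x, f (G.dilation r hr x) = (r ^ G.homDim)⁻¹ • ∫ x, f x := h.symm
  rw [h', smul_smul, mul_inv_cancel₀ hQ.ne', one_smul]

theorem inner_dilation_left {r : ℝ} (hr : 0 < r) (x y : EuclideanSpace ℝ (Fin n)) :
    inner ℝ (G.dilation r hr x) y = inner ℝ x (G.dilation r hr y) := by
  simp only [PiLp.inner_apply, dilation_apply, RCLike.inner_apply, conj_trivial]
  exact Finset.sum_congr rfl fun i _ => by ring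

theorem fourierInv_multTerm (j : ℝ) (ψ : ℕ → 𝓢(EuclideanSpace ℝ (Fin n), ℂ)) (k : ℕ) :
    𝓕⁻ (G.multTerm j ψ k) = G.kernelTerm j (fun i => 𝓕⁻ (ψ i)) k := by
  have hr : (0 : ℝ) < 2 ^ (k : ℤ) := by positivity
  have hcomp : 𝓕⁻ (G.dyadicComp (-(k : ℤ)) (ψ k)) =
      (((2 : ℝ) ^ (G.homDim * k) : ℝ) : ℂ) • G.dyadicComp (k : ℤ) (𝓕⁻ (ψ k)) := by
    ext x
    rw [smul_apply, dyadicComp_apply, SchwartzMap.fourierInv_coe,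
      SchwartzMap.fourierInv_coe, Real.fourierInv_eq, Real.fourierInv_eq,
      G.integral_comp_dilation hr, Complex.coe_smul]
    congr 1
    · rw [zpow_natCast, ← Real.rpow_natCast, ← Real.rpow_mul zero_le_two, mul_comm]
    · refine integral_congr_ae (Eventually.of_forall fun v => ?_)
      simp only [dyadicComp_apply]
      rw [G.inner_dilation_left, G.dilation_dilation_of_mul_eq_one]
      rw [← zpow_add₀ two_ne_zero, neg_add_cancel, zpow_zero]
  rw [multTerm, kernelTerm, FourierTransform.fourierInv_smul, hcomp, smul_smul,
    ← Complex.ofReal_mul, ← Real.rpow_add two_pos]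
  congr 3
  ring_nf

end HomogeneousGroup

/-! ### Dyadic series of multipliers -/

/-- The dyadic series of `min (t, 1 / t)` is bounded independently of the starting point: its terms
are dominated by the differences of the bounded function `t / (1 + t)` at `2 t` and `t`. -/
theorem sum_range_min_dyadic_le {w : ℝ} (hw : 0 < w) (N : ℕ) :
    ∑ k ∈ Finset.range N, min (w / 2 ^ k) (2 ^ k / w) ≤ 6 := by
  set t : ℕ → ℝ := fun k => 2 ^ k / w with ht
  have ht0 (k : ℕ) : 0 < t k := by positivity
  have hstep (k : ℕ) : min (w / 2 ^ k) (2 ^ k / w) ≤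
      6 * (t (k + 1) / (1 + t (k + 1)) - t k / (1 + t k)) := by
    have h1 : w / 2 ^ k = (t k)⁻¹ := (inv_div _ _).symm
    have h2 : t (k + 1) = 2 * t k := by simp only [ht]; ring
    have h3 := ht0 k
    rw [h1, h2]
    change min _ (t k) ≤ _
    generalize t k = s at h3
    have e : 6 * (2 * s / (1 + 2 * s) - s / (1 + s)) = 6 * s / ((1 + 2 * s) * (1 + s)) := by
      field_simp; ring
    rw [e, le_div_iff₀ (by positivity)]
    rcases le_total s 1 with hs | hs
    · refine (mul_le_mul_of_nonneg_right (min_le_right _ _) (by positivity)).trans ?_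
      nlinarith [mul_nonneg h3.le (sub_nonneg.2 hs), mul_nonneg (sq_nonneg s) (sub_nonneg.2 hs)]
    · refine (mul_le_mul_of_nonneg_right (min_le_left _ _) (by positivity)).trans ?_
      rw [inv_mul_le_iff₀ h3]
      nlinarith
  refine (Finset.sum_le_sum fun k _ => hstep k).trans ?_
  rw [← Finset.mul_sum, Finset.sum_range_sub (fun k => t k / (1 + t k))]
  have h1 : t N / (1 + t N) ≤ 1 := (div_le_one (by linarith [ht0 N])).2 (by linarith)
  have h2 : 0 ≤ t 0 / (1 + t 0) := by have := ht0 0; positivity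
  linarith

section BoundedSeq

variable {n : ℕ}

theorem smul_mem_schwartzZeroMomentsHat {ψ : 𝓢(EuclideanSpace ℝ (Fin n), ℂ)}
    (hψ : ψ ∈ schwartzZeroMomentsHat n) (c : ℂ) : c • ψ ∈ schwartzZeroMomentsHat n := by
  rw [mem_schwartzZeroMomentsHat_iff] at hψ ⊢
  intro l
  have e : ((c • ψ : 𝓢(EuclideanSpace ℝ (Fin n), ℂ)) : EuclideanSpace ℝ (Fin n) → ℂ) =
    c • (ψ : EuclideanSpace ℝ (Fin n) → ℂ) := rfl
  rw [e, iteratedFDeriv_const_smul_apply ((ψ.smooth ⊤).contDiffAt.of_le (natCast_le_infty l)),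
    hψ l, smul_zero]

theorem IsBoundedSeqIn.smul {ψ : ℕ → 𝓢(EuclideanSpace ℝ (Fin n), ℂ)}
    (hψ : IsBoundedSeqIn (schwartzZeroMomentsHat n) ψ) {c : ℕ → ℂ} (hc : ∀ k, ‖c k‖ ≤ 1) :
    IsBoundedSeqIn (schwartzZeroMomentsHat n) fun k => c k • ψ k := by
  refine ⟨isVonNBounded_range_iff_schwartzNorm.2 fun N => ?_,
    fun k hk => smul_mem_schwartzZeroMomentsHat (hψ.2 k hk) _⟩
  obtain ⟨B, hB0, hB⟩ := isVonNBounded_range_iff_schwartzNorm.1 hψ.1 N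
  refine ⟨B, hB0, fun k => ?_⟩
  rw [schwartzNorm_smul]
  exact (mul_le_of_le_one_left (schwartzNorm_nonneg _ _) (hc k)).trans (hB k)

theorem IsBoundedSeqIn.bddAbove {A : Set 𝓢(EuclideanSpace ℝ (Fin n), ℂ)}
    {ψ : ℕ → 𝓢(EuclideanSpace ℝ (Fin n), ℂ)}
    (hψ : IsBoundedSeqIn A ψ) (J : ℕ) : BddAbove (Set.range fun k => schwartzNorm J (ψ k)) := by
  obtain ⟨B, -, hB⟩ := isVonNBounded_range_iff_schwartzNorm.1 hψ.1 J
  exact ⟨B, by rintro _ ⟨k, rfl⟩; exact hB k⟩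

end BoundedSeq

namespace HomogeneousGroup

variable {n : ℕ} [NeZero n] {G : HomogeneousGroup n} (ν : G.HomogeneousNorm)

theorem one_le_one_add_norm (x : EuclideanSpace ℝ (Fin n)) : 1 ≤ 1 + ν.toFun x := by
  linarith [ν.nonneg x]

/-- Rapid decay at infinity, and at the origin if `k ≥ 1`, in terms of `u = 2 ^ (-k) + |η|`. -/
theorem exists_flat_bound (l M : ℕ) : ∃ (C : ℝ) (J : ℕ), 0 ≤ C ∧
    ∀ (ψ : 𝓢(EuclideanSpace ℝ (Fin n), ℂ)) (k : ℕ), (1 ≤ k → ψ ∈ schwartzZeroMomentsHat n) →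
    ∀ (η : EuclideanSpace ℝ (Fin n)) (u : ℝ), u = ((2 : ℝ) ^ k)⁻¹ + ν.toFun η →
      u ^ M * ‖iteratedFDeriv ℝ l ψ η‖ ≤ C * schwartzNorm J ψ ∧
      (u ≤ 1 → ‖iteratedFDeriv ℝ l ψ η‖ ≤ C * schwartzNorm J ψ * u ^ M) := by
  obtain ⟨A, hA1, hA, hA'⟩ := ν.exists_comparison
  have hC : A ^ M ≤ A ^ M * 2 ^ (l + M) := le_mul_of_one_le_right (by positivity)
    (one_le_pow₀ one_le_two)
  refine ⟨A ^ M * 2 ^ (l + M), l + M, by positivity, fun ψ k hψ η u hu => ?_⟩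
  have hν := ν.nonneg η
  have h2k : 0 < ((2 : ℝ) ^ k)⁻¹ := by positivity
  have hS := schwartzNorm_nonneg (l + M) ψ
  have hu0 : 0 < u := by rw [hu]; positivity
  have h1 : u ^ M * ‖iteratedFDeriv ℝ l ψ η‖ ≤ A ^ M * 2 ^ (l + M) * schwartzNorm (l + M) ψ := by
    have h2 : u ≤ A * (1 + ‖η‖) := by
      refine le_trans ?_ (hA η)
      rw [hu]
      gcongr
      exact inv_le_one_of_one_le₀ (one_le_pow₀ one_le_two)
    calc u ^ M * ‖iteratedFDeriv ℝ l ψ η‖ ≤ (A * (1 + ‖η‖)) ^ M * ‖iteratedFDeriv ℝ l ψ η‖ := by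
          gcongr
      _ = A ^ M * ((1 + ‖η‖) ^ M * ‖iteratedFDeriv ℝ l ψ η‖) := by rw [mul_pow, mul_assoc]
      _ ≤ A ^ M * (2 ^ (l + M) * schwartzNorm (l + M) ψ) := by
          refine mul_le_mul_of_nonneg_left ?_ (by positivity)
          exact one_add_pow_mul_norm_iteratedFDeriv_le_schwartzNorm (Nat.le_add_left M l)
            (Nat.le_add_right l M) ψ η
      _ = _ := by ring
  refine ⟨h1, fun hu1 => ?_⟩
  rcases Nat.eq_zero_or_pos k with rfl | hk
  · have : u = 1 := le_antisymm hu1 (by rw [hu]; simpa using hν)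
    rw [this] at h1 ⊢
    simpa using h1
  · have hflat := mem_schwartzZeroMomentsHat_iff.1 (hψ hk)
    have h3 := norm_iteratedFDeriv_le_mul_pow_of_flat (ψ.smooth ⊤) hflat M l
      (A := schwartzNorm (l + M) ψ)
      (fun y => by
        simpa using pow_mul_norm_iteratedFDeriv_le_schwartzNorm (p := 0) (by lia) le_rfl ψ y) η
    have h4 : ‖η‖ ≤ A * u := (hA' η (by linarith)).trans (by gcongr; linarith)
    calc ‖iteratedFDeriv ℝ l ψ η‖ ≤ schwartzNorm (l + M) ψ * ‖η‖ ^ M := h3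
      _ ≤ schwartzNorm (l + M) ψ * (A * u) ^ M := by gcongr
      _ = A ^ M * schwartzNorm (l + M) ψ * u ^ M := by rw [mul_pow]; ring
      _ ≤ _ := by gcongr

/-- The `k`-th term of a dyadic series is concentrated, together with its derivatives, where
`1 + |ξ|` is comparable to `2 ^ k`. -/
theorem exists_multiDeriv_multTerm_bound (j : ℝ) (α : Fin n → ℕ) : ∃ (C : ℝ) (J : ℕ), 0 ≤ C ∧
    ∀ ψ : ℕ → 𝓢(EuclideanSpace ℝ (Fin n), ℂ), (∀ k, 1 ≤ k → ψ k ∈ schwartzZeroMomentsHat n) →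
    ∀ (k : ℕ) (ξ : EuclideanSpace ℝ (Fin n)),
      ‖multiDeriv α (G.multTerm j ψ k) ξ‖ ≤
        C * schwartzNorm J (ψ k) * (1 + ν.toFun ξ) ^ (j - G.weightedLength α) *
          min ((1 + ν.toFun ξ) / 2 ^ k) (2 ^ k / (1 + ν.toFun ξ)) := by
  set s := j - G.weightedLength α with hs
  -- the exponent has to beat the growth of order `s` and leave one factor for the summation
  set M : ℕ := ⌈|s|⌉₊ + 1 with hM
  have hMs : |s| + 1 ≤ M := by rw [hM]; push_cast; gcongr; exact Nat.le_ceil _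
  obtain ⟨C, J, hC, hCJ⟩ := exists_flat_bound ν (∑ i, α i) M
  refine ⟨C, J, hC, fun ψ hψ k ξ => ?_⟩
  have hw := one_le_one_add_norm ν ξ
  set w := 1 + ν.toFun ξ with hwdef
  have hw0 : 0 < w := by linarith
  set η := G.dilation ((2 : ℝ) ^ (-(k : ℤ))) (by positivity) ξ with hη
  set u := w / 2 ^ k with hu
  have hu0 : 0 < u := by positivity
  have hue : u = ((2 : ℝ) ^ k)⁻¹ + ν.toFun η := by
    rw [hη, ν.map_dilation, zpow_neg, zpow_natCast, hu, hwdef]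
    ring
  obtain ⟨h1, h2⟩ := hCJ (ψ k) k (hψ k) η u hue
  have hS := schwartzNorm_nonneg J (ψ k)
  have hd := norm_multiDeriv_le α (ψ k) η
  rw [G.multiDeriv_multTerm, norm_smul, Real.norm_of_nonneg (by positivity)]
  have hpow : (2 : ℝ) ^ (s * k) = w ^ s * u ^ (-s) := by
    have : (2 : ℝ) ^ (s * k) = ((2 : ℝ) ^ k) ^ s := by
      rw [mul_comm, Real.rpow_mul zero_le_two, Real.rpow_natCast]
    rw [this, hu, Real.div_rpow hw0.le (by positivity), Real.rpow_neg hw0.le,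
      Real.rpow_neg (by positivity), ← mul_div_assoc, mul_inv_cancel₀ (by positivity), div_inv_eq_mul,
      one_mul]
  have e : (2 : ℝ) ^ k / w = u⁻¹ := (inv_div _ _).symm
  rw [hpow, e]
  have key : u ^ (-s) * ‖multiDeriv α (ψ k) η‖ ≤ C * schwartzNorm J (ψ k) * min u u⁻¹ := by
    rcases le_total u 1 with hu1 | hu1
    · rw [min_eq_left (hu1.trans ((one_le_inv₀ hu0).2 hu1))]
      calc u ^ (-s) * ‖multiDeriv α (ψ k) η‖
          ≤ u ^ (-s) * (C * schwartzNorm J (ψ k) * u ^ M) := by gcongr; exact hd.trans (h2 hu1)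
        _ = C * schwartzNorm J (ψ k) * u ^ (-s + M) := by
            rw [Real.rpow_add hu0, Real.rpow_natCast]; ring
        _ ≤ C * schwartzNorm J (ψ k) * u ^ (1 : ℝ) := by
            gcongr ?_ * ?_
            exact Real.rpow_le_rpow_of_exponent_ge hu0 hu1 (by linarith [le_abs_self s])
        _ = _ := by rw [Real.rpow_one]
    · rw [min_eq_right ((inv_le_one_of_one_le₀ hu1).trans hu1)]
      have h3 : ‖multiDeriv α (ψ k) η‖ ≤ C * schwartzNorm J (ψ k) * u ^ (-(M : ℝ)) := by
        rw [Real.rpow_neg hu0.le, Real.rpow_natCast, ← div_eq_mul_inv, le_div_iff₀' (by positivity)]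
        exact (mul_le_mul_of_nonneg_left hd (by positivity)).trans h1
      calc u ^ (-s) * ‖multiDeriv α (ψ k) η‖
          ≤ u ^ (-s) * (C * schwartzNorm J (ψ k) * u ^ (-(M : ℝ))) := by gcongr
        _ = C * schwartzNorm J (ψ k) * u ^ (-s + -(M : ℝ)) := by
            rw [Real.rpow_add hu0]; ring
        _ ≤ C * schwartzNorm J (ψ k) * u ^ (-1 : ℝ) := by
            gcongr ?_ * ?_
            exact Real.rpow_le_rpow_of_exponent_le hu1 (by linarith [neg_abs_le s])
        _ = _ := by rw [Real.rpow_neg_one]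
  calc w ^ s * u ^ (-s) * ‖multiDeriv α (ψ k) η‖
      = w ^ s * (u ^ (-s) * ‖multiDeriv α (ψ k) η‖) := by ring
    _ ≤ w ^ s * (C * schwartzNorm J (ψ k) * min u u⁻¹) := by gcongr
    _ = _ := by ring

/-- Uniform control of the partial sums of a dyadic series in the symbol norms. -/
theorem exists_sum_norm_multiDeriv_multTerm_bound (j : ℝ) (α : Fin n → ℕ) :
    ∃ (C : ℝ) (J : ℕ), 0 ≤ C ∧
    ∀ ψ : ℕ → 𝓢(EuclideanSpace ℝ (Fin n), ℂ), (∀ k, 1 ≤ k → ψ k ∈ schwartzZeroMomentsHat n) →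
    ∀ (B : ℝ), (∀ k, schwartzNorm J (ψ k) ≤ B) →
    ∀ (N : ℕ) (ξ : EuclideanSpace ℝ (Fin n)),
      ∑ k ∈ Finset.range N, ‖multiDeriv α (G.multTerm j ψ k) ξ‖ ≤
        C * B * (1 + ν.toFun ξ) ^ (j - G.weightedLength α) := by
  obtain ⟨C, J, hC, h⟩ := exists_multiDeriv_multTerm_bound ν j α
  refine ⟨C * 6, J, by positivity, fun ψ hψ B hB N ξ => ?_⟩
  have hw := one_le_one_add_norm ν ξ
  have hw0 : 0 < 1 + ν.toFun ξ := by linarith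
  have hB0 : 0 ≤ B := (schwartzNorm_nonneg J _).trans (hB 0)
  calc ∑ k ∈ Finset.range N, ‖multiDeriv α (G.multTerm j ψ k) ξ‖
      ≤ ∑ k ∈ Finset.range N, C * B * (1 + ν.toFun ξ) ^ (j - G.weightedLength α) *
          min ((1 + ν.toFun ξ) / 2 ^ k) (2 ^ k / (1 + ν.toFun ξ)) := by
        refine Finset.sum_le_sum fun k _ => (h ψ hψ k ξ).trans ?_
        gcongr
        exact hB k
    _ ≤ C * B * (1 + ν.toFun ξ) ^ (j - G.weightedLength α) * 6 := by
        rw [← Finset.mul_sum]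
        gcongr
        exact sum_range_min_dyadic_le hw0 N
    _ = _ := by ring

theorem contDiff_multTerm (j : ℝ) (ψ : ℕ → 𝓢(EuclideanSpace ℝ (Fin n), ℂ)) (k : ℕ) :
    ContDiff ℝ ∞ (G.multTerm j ψ k) := (G.multTerm j ψ k).smooth ⊤

theorem exists_summable_bound_multTerm_on_ball (ν : G.HomogeneousNorm) {j : ℝ}
    {ψ : ℕ → 𝓢(EuclideanSpace ℝ (Fin n), ℂ)}
    (hψ : IsBoundedSeqIn (schwartzZeroMomentsHat n) ψ) (l : ℕ) (R : ℝ) :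
    ∃ u : ℕ → ℝ, Summable u ∧
      ∀ k x, ‖x‖ < R → ‖iteratedFDeriv ℝ l (G.multTerm j ψ k) x‖ ≤ u k := by
  obtain ⟨A, hA1, hA, -⟩ := ν.exists_comparison
  have hc (α : Fin n → ℕ) : ∃ u : ℕ → ℝ, Summable u ∧
      ∀ k x, ‖x‖ < R → ‖multiDeriv α (G.multTerm j ψ k) x‖ ≤ u k := by
    obtain ⟨C, J, hC, h⟩ := exists_multiDeriv_multTerm_bound ν j α
    obtain ⟨B, hB0, hB⟩ := isVonNBounded_range_iff_schwartzNorm.1 hψ.1 J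
    set W := A * (1 + R)
    refine ⟨fun k => C * B * W ^ |j - G.weightedLength α| * (W * (1 / 2) ^ k),
      (summable_geometric_two.mul_left W).mul_left _, fun k x hx => (h ψ hψ.2 k x).trans ?_⟩
    have hw := one_le_one_add_norm ν x
    have hwW : 1 + ν.toFun x ≤ W :=
      (hA x).trans (mul_le_mul_of_nonneg_left (by linarith) (by linarith))
    have hW : 0 ≤ W := by linarith
    have h1 : (1 + ν.toFun x) ^ (j - G.weightedLength α) ≤ W ^ |j - G.weightedLength α| :=
      (Real.rpow_le_rpow_of_exponent_le hw (le_abs_self _)).trans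
        (Real.rpow_le_rpow (by linarith) hwW (abs_nonneg _))
    have h2 : min ((1 + ν.toFun x) / 2 ^ k) (2 ^ k / (1 + ν.toFun x)) ≤ W * (1 / 2) ^ k := by
      refine (min_le_left _ _).trans ?_
      rw [one_div, inv_pow, ← div_eq_mul_inv]
      gcongr
    have h3 := hB k
    have h4 := schwartzNorm_nonneg J (ψ k)
    beta_reduce
    gcongr
  choose u hu hub using hc
  refine ⟨fun k => ∑ c : Fin l → Fin n, u (multiCount c) k, summable_sum fun c _ => hu _,
    fun k x hx => ?_⟩
  exact (norm_iteratedFDeriv_le_sum_multiDeriv (contDiff_multTerm j ψ k) l x).trans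
    (Finset.sum_le_sum fun c _ => hub _ k x hx)

theorem hasFTaylorSeriesUpTo_tsum_multTerm (ν : G.HomogeneousNorm) {j : ℝ}
    {ψ : ℕ → 𝓢(EuclideanSpace ℝ (Fin n), ℂ)}
    (hψ : IsBoundedSeqIn (schwartzZeroMomentsHat n) ψ) :
    HasFTaylorSeriesUpTo ∞ (fun x => ∑' k, G.multTerm j ψ k x)
      (fun x l => ∑' k, iteratedFDeriv ℝ l (G.multTerm j ψ k) x) :=
  hasFTaylorSeriesUpTo_tsum_of_bound_on_ball (contDiff_multTerm j ψ)
    (exists_summable_bound_multTerm_on_ball ν hψ)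

theorem hasSum_multiDeriv_multTerm (ν : G.HomogeneousNorm) {j : ℝ}
    {ψ : ℕ → 𝓢(EuclideanSpace ℝ (Fin n), ℂ)}
    (hψ : IsBoundedSeqIn (schwartzZeroMomentsHat n) ψ) (α : Fin n → ℕ) (x : EuclideanSpace ℝ (Fin n)) :
    HasSum (fun k => multiDeriv α (G.multTerm j ψ k) x)
      (multiDeriv α (fun x => ∑' k, G.multTerm j ψ k x) x) := by
  obtain ⟨u, hu, hub⟩ := exists_summable_bound_multTerm_on_ball ν (j := j) hψ (∑ i, α i) (‖x‖ + 1)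
  have hs : Summable fun k => iteratedFDeriv ℝ (∑ i, α i) (G.multTerm j ψ k) x :=
    .of_norm_bounded hu fun k => hub k x (by linarith)
  have h := ContinuousMultilinearMap.hasSum_eval hs.hasSum
    (fun k => EuclideanSpace.single (finSigmaFinEquiv.symm k).1 (1 : ℝ))
  rw [(hasFTaylorSeriesUpTo_tsum_multTerm ν hψ).eq_iteratedFDeriv
    (natCast_le_infty (∑ i, α i)) x] at h
  exact h

theorem hasSum_multTerm (ν : G.HomogeneousNorm) {j : ℝ}
    {ψ : ℕ → 𝓢(EuclideanSpace ℝ (Fin n), ℂ)}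
    (hψ : IsBoundedSeqIn (schwartzZeroMomentsHat n) ψ) (x : EuclideanSpace ℝ (Fin n)) :
    HasSum (fun k => G.multTerm j ψ k x) (∑' k, G.multTerm j ψ k x) := by
  simpa only [multiDeriv_zero] using hasSum_multiDeriv_multTerm ν hψ 0 x (j := j)

theorem tendstoSmooth_sum_multTerm (ν : G.HomogeneousNorm) {j : ℝ}
    {ψ : ℕ → 𝓢(EuclideanSpace ℝ (Fin n), ℂ)}
    (hψ : IsBoundedSeqIn (schwartzZeroMomentsHat n) ψ) :
    TendstoSmooth (fun N ξ => ∑ k ∈ Finset.range N, G.multTerm j ψ k ξ)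
      (fun x => ∑' k, G.multTerm j ψ k x) := by
  intro α B hB
  obtain ⟨R, hR⟩ := hB.isBounded.exists_norm_le
  obtain ⟨u, hu, hub⟩ := exists_summable_bound_multTerm_on_ball ν (j := j) hψ (∑ i, α i) (R + 1)
  have h := tendstoUniformlyOn_tsum_nat (f := fun k => multiDeriv α (G.multTerm j ψ k)) hu
    (s := B) fun k x hx => (norm_multiDeriv_le _ _ _).trans (hub k x (by linarith [hR x hx]))
  have e1 : (fun N => multiDeriv α fun ξ => ∑ k ∈ Finset.range N, G.multTerm j ψ k ξ) =
      fun N x => ∑ k ∈ Finset.range N, multiDeriv α (G.multTerm j ψ k) x := by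
    funext N x
    exact multiDeriv_sum α _ (fun k _ => contDiff_multTerm j ψ k) x
  have e2 : (multiDeriv α fun x => ∑' k, G.multTerm j ψ k x) =
      fun x => ∑' k, multiDeriv α (G.multTerm j ψ k) x := by
    funext x
    exact (hasSum_multiDeriv_multTerm ν hψ α x).tsum_eq.symm
  rw [e1, e2]
  exact h

end HomogeneousGroup

/-! ### Multipliers as tempered distributions -/

section TemperateGrowth

variable {n : ℕ}

theorem isGivenBy_toTemperedDistribution {m : EuclideanSpace ℝ (Fin n) → ℂ}
    (hm : Function.HasTemperateGrowth m) : IsGivenBy (hm.toTemperedDistribution volume) m := by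
  refine fun g => ⟨?_, rfl⟩
  have h := (SchwartzMap.smulLeftCLM ℂ m g).integrable (μ := volume)
  rw [SchwartzMap.smulLeftCLM_apply hm] at h
  simpa only [Pi.smul_apply', smul_eq_mul, mul_comm] using h

theorem integrable_one_add_norm_pow_mul (g : 𝓢(EuclideanSpace ℝ (Fin n), ℂ)) (K : ℕ) :
    Integrable fun x => (1 + ‖x‖) ^ K * ‖g x‖ := by
  refine Integrable.mono' (((g.integrable.norm).add (g.integrable_pow_mul volume K)).const_mul
    (2 ^ (K - 1))) (by fun_prop) (Eventually.of_forall fun x => ?_)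
  rw [Real.norm_of_nonneg (by positivity)]
  refine (mul_le_mul_of_nonneg_right (add_pow_le zero_le_one (norm_nonneg x) K)
    (norm_nonneg _)).trans (le_of_eq ?_)
  simp only [one_pow, Pi.add_apply]
  ring

theorem schwartzToDist_apply (f g : 𝓢(EuclideanSpace ℝ (Fin n), ℂ)) :
    schwartzToDist f g = ∫ x, g x * f x :=
  SchwartzMap.toTemperedDistributionCLM_apply_apply volume f g

theorem schwartzToDist_sum {ι : Type*} (s : Finset ι)
    (f : ι → 𝓢(EuclideanSpace ℝ (Fin n), ℂ)) :
    schwartzToDist (∑ k ∈ s, f k) = ∑ k ∈ s, schwartzToDist (f k) :=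
  map_sum (SchwartzMap.toTemperedDistributionCLM (EuclideanSpace ℝ (Fin n)) ℂ volume) _ _

theorem IsGivenBy.unique {T T' : 𝓢'(EuclideanSpace ℝ (Fin n), ℂ)}
    {m : EuclideanSpace ℝ (Fin n) → ℂ} (hT : IsGivenBy T m) (hT' : IsGivenBy T' m) : T = T' :=
  DFunLike.ext _ _ fun g => (hT g).2.trans (hT' g).2.symm

end TemperateGrowth

namespace HomogeneousGroup

variable {n : ℕ} [NeZero n] {G : HomogeneousGroup n} (ν : G.HomogeneousNorm)

theorem multipliers_mono {j j' : ℝ} (h : j ≤ j') : multipliers ν j ⊆ multipliers ν j' := by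
  rintro m ⟨hm, hb⟩
  refine ⟨hm, fun α => ?_⟩
  obtain ⟨C, hC, hCb⟩ := hb α
  refine ⟨C, hC, fun ξ => (hCb ξ).trans ?_⟩
  have := one_le_one_add_norm ν ξ
  gcongr

/-- Multipliers are symbols of temperate growth, hence tempered distributions. -/
theorem hasTemperateGrowth_of_mem_multipliers {j : ℝ} {m : EuclideanSpace ℝ (Fin n) → ℂ}
    (hm : m ∈ multipliers ν j) : Function.HasTemperateGrowth m := by
  obtain ⟨A, hA1, hA, -⟩ := ν.exists_comparison
  refine ⟨hm.1, fun l => ?_⟩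
  choose C hC hCb using hm.2
  set K := ⌈|j|⌉₊
  refine ⟨K, ∑ c : Fin l → Fin n, C (multiCount c) * A ^ K, fun x => ?_⟩
  refine (norm_iteratedFDeriv_le_sum_multiDeriv hm.1 l x).trans ?_
  rw [Finset.sum_mul]
  refine Finset.sum_le_sum fun c _ => (hCb _ x).trans ?_
  have hw := one_le_one_add_norm ν x
  rw [mul_assoc, ← mul_pow]
  refine mul_le_mul_of_nonneg_left ?_ (hC _).le
  calc (1 + ν.toFun x) ^ (j - G.weightedLength (multiCount c)) ≤ (1 + ν.toFun x) ^ (K : ℝ) := by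
        refine Real.rpow_le_rpow_of_exponent_le hw ?_
        linarith [G.weightedLength_nonneg (multiCount c), le_abs_self j, Nat.le_ceil |j|]
    _ = (1 + ν.toFun x) ^ K := Real.rpow_natCast _ _
    _ ≤ _ := by gcongr; exact hA x

/-! ### Convergence of dyadic series -/

theorem sum_multTerm_mem_multipliers {j : ℝ} {ψ : ℕ → 𝓢(EuclideanSpace ℝ (Fin n), ℂ)}
    (hψ : IsBoundedSeqIn (schwartzZeroMomentsHat n) ψ) (N : ℕ) :
    (fun ξ => ∑ k ∈ Finset.range N, G.multTerm j ψ k ξ) ∈ multipliers ν j := by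
  refine ⟨ContDiff.sum fun k _ => contDiff_multTerm j ψ k, fun α => ?_⟩
  obtain ⟨C, J, hC, h⟩ := exists_sum_norm_multiDeriv_multTerm_bound ν j α
  obtain ⟨B, hB0, hB⟩ := isVonNBounded_range_iff_schwartzNorm.1 hψ.1 J
  refine ⟨C * B + 1, by positivity, fun ξ => ?_⟩
  rw [multiDeriv_sum α _ fun k _ => contDiff_multTerm j ψ k]
  refine (norm_sum_le _ _).trans ((h ψ hψ.2 B hB N ξ).trans ?_)
  have := one_le_one_add_norm ν ξ
  gcongr
  linarith

/-- The sum of a dyadic series inherits the uniform bounds of its partial sums. -/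
theorem exists_multiDeriv_tsum_bound (j : ℝ) (α : Fin n → ℕ) :
    ∃ (C : ℝ) (J : ℕ), 0 ≤ C ∧
    ∀ ψ : ℕ → 𝓢(EuclideanSpace ℝ (Fin n), ℂ), IsBoundedSeqIn (schwartzZeroMomentsHat n) ψ →
    ∀ (B : ℝ), (∀ k, schwartzNorm J (ψ k) ≤ B) → ∀ ξ : EuclideanSpace ℝ (Fin n),
      ‖multiDeriv α (fun x => ∑' k, G.multTerm j ψ k x) ξ‖ ≤
        C * B * (1 + ν.toFun ξ) ^ (j - G.weightedLength α) := by
  obtain ⟨C, J, hC, h⟩ := exists_sum_norm_multiDeriv_multTerm_bound ν j α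
  refine ⟨C, J, hC, fun ψ hψ B hB ξ => ?_⟩
  refine le_of_tendsto (hasSum_multiDeriv_multTerm ν hψ α ξ).tendsto_sum_nat.norm
    (Eventually.of_forall fun N => ?_)
  exact (norm_sum_le _ _).trans (h ψ hψ.2 B hB N ξ)

theorem tsum_multTerm_mem_multipliers {j : ℝ} {ψ : ℕ → 𝓢(EuclideanSpace ℝ (Fin n), ℂ)}
    (hψ : IsBoundedSeqIn (schwartzZeroMomentsHat n) ψ) :
    (fun ξ => ∑' k, G.multTerm j ψ k ξ) ∈ multipliers ν j := by
  refine ⟨(hasFTaylorSeriesUpTo_tsum_multTerm ν hψ).contDiff, fun α => ?_⟩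
  obtain ⟨C, J, hC, h⟩ := exists_multiDeriv_tsum_bound ν j α
  obtain ⟨B, hB0, hB⟩ := isVonNBounded_range_iff_schwartzNorm.1 hψ.1 J
  refine ⟨C * B + 1, by positivity, fun ξ => (h ψ hψ B hB ξ).trans ?_⟩
  have := one_le_one_add_norm ν ξ
  gcongr
  linarith

/-- Convergence of a dyadic series in the space of tempered distributions, by dominated
convergence. -/
theorem exists_tendsto_schwartzToDist_multTerm (ν : G.HomogeneousNorm) {j : ℝ}
    {ψ : ℕ → 𝓢(EuclideanSpace ℝ (Fin n), ℂ)}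
    (hψ : IsBoundedSeqIn (schwartzZeroMomentsHat n) ψ) :
    ∃ T : 𝓢'(EuclideanSpace ℝ (Fin n), ℂ), IsGivenBy T (fun ξ => ∑' k, G.multTerm j ψ k ξ) ∧
      Tendsto (fun N => ∑ k ∈ Finset.range N, schwartzToDist (G.multTerm j ψ k)) atTop (𝓝 T) := by
  have hm := hasTemperateGrowth_of_mem_multipliers ν (tsum_multTerm_mem_multipliers ν hψ (j := j))
  refine ⟨_, isGivenBy_toTemperedDistribution hm, ?_⟩
  rw [PointwiseConvergenceCLM.tendsto_iff_forall_tendsto]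
  intro g
  have hval (N : ℕ) : (∑ k ∈ Finset.range N, schwartzToDist (G.multTerm j ψ k)) g =
      ∫ x, g x * ∑ k ∈ Finset.range N, G.multTerm j ψ k x := by
    rw [← schwartzToDist_sum, schwartzToDist_apply]
    simp
  simp only [hval]
  obtain ⟨A, hA1, hA, -⟩ := ν.exists_comparison
  obtain ⟨C, J, hC, h⟩ := exists_sum_norm_multiDeriv_multTerm_bound ν j 0
  obtain ⟨B, hB0, hB⟩ := isVonNBounded_range_iff_schwartzNorm.1 hψ.1 J
  set K := ⌈|j|⌉₊
  refine tendsto_integral_of_dominated_convergence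
    (fun x => C * B * A ^ K * ((1 + ‖x‖) ^ K * ‖g x‖)) (fun N => ?_)
    ((integrable_one_add_norm_pow_mul g K).const_mul _) (fun N => Eventually.of_forall fun x => ?_)
    (Eventually.of_forall fun x => ?_)
  · refine Continuous.aestronglyMeasurable (g.continuous.mul ?_)
    exact continuous_finsetSum _ fun k _ => (G.multTerm j ψ k).continuous
  · have hw := one_le_one_add_norm ν x
    have h1 := h ψ hψ.2 B hB N x
    simp only [multiDeriv_zero] at h1
    have h2 : (1 + ν.toFun x) ^ (j - G.weightedLength 0) ≤ A ^ K * (1 + ‖x‖) ^ K := by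
      rw [← mul_pow]
      calc (1 + ν.toFun x) ^ (j - G.weightedLength 0) ≤ (1 + ν.toFun x) ^ (K : ℝ) := by
            refine Real.rpow_le_rpow_of_exponent_le hw ?_
            linarith [G.weightedLength_nonneg 0, le_abs_self j, Nat.le_ceil |j|]
        _ = (1 + ν.toFun x) ^ K := Real.rpow_natCast _ _
        _ ≤ _ := by gcongr; exact hA x
    rw [norm_mul]
    calc ‖g x‖ * ‖∑ k ∈ Finset.range N, G.multTerm j ψ k x‖
        ≤ ‖g x‖ * (C * B * (A ^ K * (1 + ‖x‖) ^ K)) := by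
          refine mul_le_mul_of_nonneg_left ?_ (norm_nonneg _)
          exact (norm_sum_le _ _).trans (h1.trans (by gcongr))
      _ = _ := by ring
  · exact ((hasSum_multTerm ν hψ x).tendsto_sum_nat).const_mul _

/-! ### Uniform estimates for dyadic series -/

theorem multiplierNorm_nonneg (j : ℝ) (I : ℕ) (m : EuclideanSpace ℝ (Fin n) → ℂ) :
    0 ≤ multiplierNorm ν j I m :=
  Finset.sum_nonneg fun _ _ => Real.iSup_nonneg fun ξ =>
    mul_nonneg (Real.rpow_nonneg (by linarith [ν.nonneg ξ]) _) (norm_nonneg _)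

theorem exists_multiplierNorm_le (j : ℝ) (I : ℕ) : ∃ (C : ℝ) (J : ℕ), 0 ≤ C ∧
    ∀ ψ : ℕ → 𝓢(EuclideanSpace ℝ (Fin n), ℂ), IsBoundedSeqIn (schwartzZeroMomentsHat n) ψ →
      ∀ m : EuclideanSpace ℝ (Fin n) → ℂ,
        (∀ ξ, Tendsto (fun N => ∑ k ∈ Finset.range N, G.multTerm j ψ k ξ) atTop (𝓝 (m ξ))) →
        multiplierNorm ν j I m ≤ C * ⨆ k, schwartzNorm J (ψ k) := by
  choose C J hC h using exists_multiDeriv_tsum_bound ν j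
  refine ⟨∑ α ∈ G.multiIndices I, C α, (G.multiIndices I).sup J,
    Finset.sum_nonneg fun α _ => hC α, fun ψ hψ m hm => ?_⟩
  obtain rfl : m = fun ξ => ∑' k, G.multTerm j ψ k ξ :=
    funext fun ξ => tendsto_nhds_unique (hm ξ) (hasSum_multTerm ν hψ ξ).tendsto_sum_nat
  rw [Finset.sum_mul]
  refine Finset.sum_le_sum fun α hα => ciSup_le fun ξ => ?_
  have hw := one_le_one_add_norm ν ξ
  have hw0 : 0 < 1 + ν.toFun ξ := by linarith
  have h1 := h α ψ hψ (⨆ k, schwartzNorm ((G.multiIndices I).sup J) (ψ k))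
    (fun k => (schwartzNorm_mono (Finset.le_sup hα) _).trans (le_ciSup (hψ.bddAbove _) k)) ξ
  refine (mul_le_mul_of_nonneg_left h1 (Real.rpow_nonneg hw0.le _)).trans (le_of_eq ?_)
  rw [mul_left_comm, ← Real.rpow_add hw0, sub_add_sub_cancel, sub_self, Real.rpow_zero, mul_one]

/-- A dyadic series of order `j` is also one of order `j' > j`, for the rescaled sequence
`2 ^ (-(j' - j) k) ψ_k`. -/
theorem exists_multiplierNorm_le_of_lt {j j' : ℝ} (hj : j < j') (I : ℕ) : ∃ (C : ℝ) (J : ℕ), 0 ≤ C ∧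
    ∀ ψ : ℕ → 𝓢(EuclideanSpace ℝ (Fin n), ℂ), IsBoundedSeqIn (schwartzZeroMomentsHat n) ψ →
      ∀ m : EuclideanSpace ℝ (Fin n) → ℂ,
        (∀ ξ, Tendsto (fun N => ∑ k ∈ Finset.range N, G.multTerm j ψ k ξ) atTop (𝓝 (m ξ))) →
        multiplierNorm ν j' I m ≤
          C * ⨆ k : ℕ, (2 : ℝ) ^ (-((j' - j) * k)) * schwartzNorm J (ψ k) := by
  obtain ⟨C, J, hC, h⟩ := exists_multiplierNorm_le ν j' I
  refine ⟨C, J, hC, fun ψ hψ m hm => ?_⟩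
  set c : ℕ → ℂ := fun k => (((2 : ℝ) ^ (-((j' - j) * k)) : ℝ) : ℂ) with hc
  have hcn (k : ℕ) : ‖c k‖ = (2 : ℝ) ^ (-((j' - j) * k)) := by
    rw [hc, Complex.norm_real, Real.norm_of_nonneg (by positivity)]
  have hc1 (k : ℕ) : ‖c k‖ ≤ 1 := by
    rw [hcn]
    refine Real.rpow_le_one_of_one_le_of_nonpos one_le_two (neg_nonpos.2 ?_)
    exact mul_nonneg (by linarith) (Nat.cast_nonneg k)
  have h1 := h (fun k => c k • ψ k) (hψ.smul hc1) m fun ξ => by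
    refine (hm ξ).congr fun N => Finset.sum_congr rfl fun k _ => ?_
    rw [multTerm_apply, multTerm_apply, smul_apply, hc, Complex.coe_smul, smul_smul,
      ← Real.rpow_add two_pos]
    congr 2
    ring_nf
  simpa only [schwartzNorm_smul, hcn] using h1

/-- A dyadic series of order `j` converges in the norms of every order `j' > j`: its tail is the
dyadic series of the truncated sequence. -/
theorem tendsto_multiplierNorm_sum_sub {j j' : ℝ} (hj : j < j')
    {ψ : ℕ → 𝓢(EuclideanSpace ℝ (Fin n), ℂ)}
    (hψ : IsBoundedSeqIn (schwartzZeroMomentsHat n) ψ) (I : ℕ) :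
    Tendsto (fun N => multiplierNorm ν j' I
      (fun ξ => (∑ k ∈ Finset.range N, G.multTerm j ψ k ξ) - ∑' k, G.multTerm j ψ k ξ))
      atTop (𝓝 0) := by
  obtain ⟨C, J, hC, h⟩ := exists_multiplierNorm_le_of_lt ν hj I
  obtain ⟨B, hB0, hB⟩ := isVonNBounded_range_iff_schwartzNorm.1 hψ.1 J
  have hbound (N : ℕ) : multiplierNorm ν j' I
      (fun ξ => (∑ k ∈ Finset.range N, G.multTerm j ψ k ξ) - ∑' k, G.multTerm j ψ k ξ) ≤
      C * (((2 : ℝ) ^ (-(j' - j))) ^ N * B) := by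
    set c : ℕ → ℂ := fun k => if k < N then 0 else -1 with hc
    have hc1 (k : ℕ) : ‖c k‖ ≤ 1 := by
      simp only [hc]; split_ifs <;> simp
    refine (h (fun k => c k • ψ k) (hψ.smul hc1) _ fun ξ => ?_).trans ?_
    · refine ((hasSum_multTerm ν hψ ξ).tendsto_sum_nat.const_sub _).congr' ?_
      filter_upwards [eventually_ge_atTop N] with N' hN'
      have e (k : ℕ) : G.multTerm j (fun k => c k • ψ k) k ξ = c k * G.multTerm j ψ k ξ := by
        rw [multTerm_apply, multTerm_apply, smul_apply, smul_eq_mul, mul_smul_comm]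
      simp only [e]
      rw [← Finset.sum_range_add_sum_Ico _ hN', ← Finset.sum_range_add_sum_Ico _ hN',
        sub_add_cancel_left, ← Finset.sum_neg_distrib]
      have e1 : ∑ k ∈ Finset.range N, c k * G.multTerm j ψ k ξ = 0 :=
        Finset.sum_eq_zero fun k hk => by simp [hc, Finset.mem_range.1 hk]
      rw [e1, zero_add]
      refine Finset.sum_congr rfl fun k hk => ?_
      simp [hc, not_lt.2 (Finset.mem_Ico.1 hk).1]
    · refine mul_le_mul_of_nonneg_left (ciSup_le fun k => ?_) hC
      rw [schwartzNorm_smul]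
      by_cases hk : k < N
      · simp only [hc, hk, if_true, norm_zero, zero_mul, mul_zero]
        positivity
      · simp only [hc, hk, if_false, norm_neg, norm_one, one_mul]
        refine mul_le_mul ?_ (hB k) (schwartzNorm_nonneg _ _) (by positivity)
        rw [← Real.rpow_natCast, ← Real.rpow_mul zero_le_two]
        refine Real.rpow_le_rpow_of_exponent_le one_le_two ?_
        have : (N : ℝ) ≤ k := by exact_mod_cast not_lt.1 hk
        nlinarith
  refine squeeze_zero (fun N => multiplierNorm_nonneg ν _ _ _) hbound ?_
  have hlt : (2 : ℝ) ^ (-(j' - j)) < 1 :=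
    Real.rpow_lt_one_of_one_lt_of_neg one_lt_two (by linarith)
  simpa using ((tendsto_pow_atTop_nhds_zero_of_lt_one (by positivity) hlt).mul_const B).const_mul C

end HomogeneousGroup

/-! ### Dyadic decomposition of a multiplier -/

section Localization

variable {n : ℕ}

/-- The closed Euclidean annulus. -/
def closedAnnulus (n : ℕ) (r R : ℝ) : Set (EuclideanSpace ℝ (Fin n)) := {x | r ≤ ‖x‖ ∧ ‖x‖ ≤ R}

theorem isClosed_closedAnnulus (r R : ℝ) : IsClosed (closedAnnulus n r R) :=
  (isClosed_le continuous_const continuous_norm).inter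
    (isClosed_le continuous_norm continuous_const)

theorem isCompact_closedAnnulus (r R : ℝ) : IsCompact (closedAnnulus n r R) :=
  (isCompact_closedBall (0 : EuclideanSpace ℝ (Fin n)) R).of_isClosed_subset
    (isClosed_closedAnnulus r R) fun x hx => by simpa using hx.2

/-- Cutting off to an annulus a family of functions with uniformly bounded derivatives there gives
a bounded family of Schwartz functions. -/
theorem isVonNBounded_range_of_cutoff {r R : ℝ} (θ : 𝓢(EuclideanSpace ℝ (Fin n), ℂ))
    (hθ : tsupport θ ⊆ closedAnnulus n r R) {g : ℕ → EuclideanSpace ℝ (Fin n) → ℂ}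
    (hg : ∀ k, ContDiff ℝ ∞ (g k))
    (hgb : ∀ l, ∃ B, ∀ k, ∀ x ∈ closedAnnulus n r R, ‖iteratedFDeriv ℝ l (g k) x‖ ≤ B)
    {ψ : ℕ → 𝓢(EuclideanSpace ℝ (Fin n), ℂ)} (hψ : ∀ k x, ψ k x = θ x * g k x) :
    Bornology.IsVonNBounded ℂ (Set.range ψ) := by
  rw [(schwartz_withSeminorms ℂ (EuclideanSpace ℝ (Fin n)) ℂ).isVonNBounded_iff_seminorm_bounded]
  choose B hB using hgb
  rintro ⟨p, l⟩
  set D : ℝ := |R| ^ p * ∑ i ∈ Finset.range (l + 1),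
    (l.choose i : ℝ) * SchwartzMap.seminorm ℂ 0 i θ * |B (l - i)| with hD
  have hD0 : 0 ≤ D := by positivity
  refine ⟨D + 1, by positivity, ?_⟩
  rintro _ ⟨k, rfl⟩
  refine lt_of_le_of_lt (SchwartzMap.seminorm_le_bound ℂ p l _ hD0 fun x => ?_) (lt_add_one D)
  have e : (ψ k : EuclideanSpace ℝ (Fin n) → ℂ) = fun x => θ x * g k x := funext (hψ k)
  by_cases hx : x ∈ closedAnnulus n r R
  · rw [e]
    have h1 := norm_iteratedFDeriv_mul_le (θ.smooth ⊤) (hg k) x (natCast_le_infty l)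
    refine mul_le_mul ?_ (h1.trans (Finset.sum_le_sum fun i _ => ?_)) (norm_nonneg _)
      (by positivity)
    · exact pow_le_pow_left₀ (norm_nonneg _) (hx.2.trans (le_abs_self R)) p
    · refine mul_le_mul (mul_le_mul_of_nonneg_left ?_ (Nat.cast_nonneg _))
        ((hB _ k x hx).trans (le_abs_self _)) (norm_nonneg _) (by positivity)
      exact SchwartzMap.norm_iteratedFDeriv_le_seminorm ℂ θ i x
  · have h1 : tsupport (ψ k) ⊆ closedAnnulus n r R := by
      rw [e]
      exact (tsupport_mul_subset_left (f := θ) (g := g k)).trans hθ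
    have h2 : iteratedFDeriv ℝ l (ψ k) x = 0 := by
      by_contra hne
      exact hx (h1 (support_iteratedFDeriv_subset l hne))
    rw [h2, norm_zero, mul_zero]
    exact hD0

theorem mem_schwartzZeroMomentsHat_of_notMem_tsupport {ψ : 𝓢(EuclideanSpace ℝ (Fin n), ℂ)}
    (h : (0 : EuclideanSpace ℝ (Fin n)) ∉ tsupport ψ) : ψ ∈ schwartzZeroMomentsHat n :=
  mem_schwartzZeroMomentsHat_iff.2 fun l => by
    by_contra hne
    exact h (support_iteratedFDeriv_subset l hne)

end Localization

namespace HomogeneousGroup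

variable {n : ℕ} [NeZero n] {G : HomogeneousGroup n} (ν : G.HomogeneousNorm)

/-- The rescalings `2 ^ (-j k) m ∘ δ_{2 ^ k}` of a multiplier of order `j` have uniformly bounded
derivatives on annuli. -/
theorem exists_rescaled_multiplier_bound {j : ℝ} {m : EuclideanSpace ℝ (Fin n) → ℂ}
    (hm : m ∈ multipliers ν j) {r : ℝ} (hr : 0 < r) (R : ℝ) (l : ℕ) :
    ∃ B, ∀ k : ℕ, ∀ x ∈ closedAnnulus n r R,
      ‖iteratedFDeriv ℝ l (fun y => (((2 : ℝ) ^ (-(j * k)) : ℝ) : ℂ) •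
        m (G.dilation ((2 : ℝ) ^ k) (by positivity) y)) x‖ ≤ B := by
  obtain ⟨c, C', hc, hC', hcC⟩ := ν.exists_bounds_on_annulus hr R
  choose C hC hCb using hm.2
  have hcomp (k : ℕ) : ContDiff ℝ ∞ fun y => m (G.dilation ((2 : ℝ) ^ k) (by positivity) y) :=
    hm.1.comp (G.dilation _ _).contDiff
  have hα (α : Fin n → ℕ) (k : ℕ) (x) (hx : x ∈ closedAnnulus n r R) :
      ‖multiDeriv α (fun y => (((2 : ℝ) ^ (-(j * k)) : ℝ) : ℂ) •
        m (G.dilation ((2 : ℝ) ^ k) (by positivity) y)) x‖ ≤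
      C α * ((1 + C') ^ (j - G.weightedLength α) + c ^ (j - G.weightedLength α)) := by
    set s := j - G.weightedLength α with hs
    obtain ⟨h1, h2⟩ := hcC x hx.1 hx.2
    have hk : (0 : ℝ) < 2 ^ k := by positivity
    have hk1 : (1 : ℝ) ≤ 2 ^ k := one_le_pow₀ one_le_two
    rw [multiDeriv_const_smul α (hcomp k), G.multiDeriv_comp_dilation α hm.1, Complex.coe_smul,
      smul_smul, norm_smul, Real.norm_of_nonneg (by positivity)]
    have e : (2 : ℝ) ^ (-(j * k)) * ((2 : ℝ) ^ k) ^ G.weightedLength α = ((2 : ℝ) ^ k) ^ (-s) := by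
      rw [← Real.rpow_natCast, ← Real.rpow_mul zero_le_two, ← Real.rpow_mul zero_le_two,
        ← Real.rpow_add two_pos]
      congr 1
      rw [hs]; ring
    have hpow : (1 + 2 ^ k * ν.toFun x) ^ s ≤ ((2 : ℝ) ^ k) ^ s * ((1 + C') ^ s + c ^ s) := by
      have hν := ν.nonneg x
      rcases le_total 0 s with h0 | h0
      · calc (1 + 2 ^ k * ν.toFun x) ^ s ≤ (2 ^ k * (1 + C')) ^ s := by
              refine Real.rpow_le_rpow (by positivity) ?_ h0
              nlinarith
          _ = ((2 : ℝ) ^ k) ^ s * (1 + C') ^ s := Real.mul_rpow hk.le (by positivity)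
          _ ≤ _ := by
              gcongr
              exact le_add_of_nonneg_right (by positivity)
      · calc (1 + 2 ^ k * ν.toFun x) ^ s ≤ (2 ^ k * c) ^ s := by
              refine Real.rpow_le_rpow_of_nonpos (by positivity) ?_ h0
              nlinarith
          _ = ((2 : ℝ) ^ k) ^ s * c ^ s := Real.mul_rpow hk.le hc.le
          _ ≤ _ := by
              gcongr
              exact le_add_of_nonneg_left (by positivity)
    have h3 := hCb α (G.dilation ((2 : ℝ) ^ k) (by positivity) x)
    rw [ν.map_dilation] at h3
    rw [e]
    calc ((2 : ℝ) ^ k) ^ (-s) * ‖multiDeriv α m (G.dilation ((2 : ℝ) ^ k) (by positivity) x)‖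
        ≤ ((2 : ℝ) ^ k) ^ (-s) * (C α * (((2 : ℝ) ^ k) ^ s * ((1 + C') ^ s + c ^ s))) := by
          refine mul_le_mul_of_nonneg_left (h3.trans ?_) (by positivity)
          exact mul_le_mul_of_nonneg_left hpow (hC α).le
      _ = (((2 : ℝ) ^ k) ^ (-s) * ((2 : ℝ) ^ k) ^ s) * (C α * ((1 + C') ^ s + c ^ s)) := by ring
      _ = _ := by rw [← Real.rpow_add hk, neg_add_cancel, Real.rpow_zero, one_mul]
  refine ⟨∑ c' : Fin l → Fin n, C (multiCount c') *
    ((1 + C') ^ (j - G.weightedLength (multiCount c')) +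
      c ^ (j - G.weightedLength (multiCount c'))), fun k x hx => ?_⟩
  exact (norm_iteratedFDeriv_le_sum_multiDeriv ((hcomp k).const_smul _) l x).trans
    (Finset.sum_le_sum fun c' _ => hα _ k x hx)

/-- The dyadic partition of unity associated with the dilations decomposes a multiplier into
rescalings of functions supported in a fixed annulus. -/
theorem exists_dyadic_decomposition {j : ℝ} {m : EuclideanSpace ℝ (Fin n) → ℂ}
    (hm : m ∈ multipliers ν j) :
    ∃ ψ : ℕ → 𝓢(EuclideanSpace ℝ (Fin n), ℂ), IsBoundedSeqIn (schwartzZeroMomentsHat n) ψ ∧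
      ∀ ξ, Tendsto (fun N => ∑ k ∈ Finset.range N, G.multTerm j ψ k ξ) atTop (𝓝 (m ξ)) := by
  let b : ContDiffBump (0 : EuclideanSpace ℝ (Fin n)) := ⟨1, 2, one_pos, one_lt_two⟩
  let χ : EuclideanSpace ℝ (Fin n) → ℂ := fun x => (b x : ℂ)
  have hχ : ContDiff ℝ ∞ χ := Complex.ofRealCLM.contDiff.comp b.contDiff
  have hχ1 (x : EuclideanSpace ℝ (Fin n)) (hx : ‖x‖ ≤ 1) : χ x = 1 := by
    have : b x = 1 := b.one_of_mem_closedBall (by simpa using hx)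
    simp [χ, this]
  have hχ0 (x : EuclideanSpace ℝ (Fin n)) (hx : 2 ≤ ‖x‖) : χ x = 0 := by
    have : b x = 0 := b.zero_of_le_dist (by simpa using hx)
    simp [χ, this]
  have hχc : HasCompactSupport χ :=
    HasCompactSupport.of_support_subset_isCompact
      (isCompact_closedBall (0 : EuclideanSpace ℝ (Fin n)) 2) fun x hx => by
        by_contra h
        exact hx (hχ0 x (by simpa using (not_le.1 (by simpa using h)).le))
  -- the annular cutoff
  let θ : EuclideanSpace ℝ (Fin n) → ℂ := fun x => χ x - χ (G.dilation 2 two_pos x)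
  have hθ : ContDiff ℝ ∞ θ := hχ.sub (hχ.comp (G.dilation 2 two_pos).contDiff)
  have hQ : (0 : ℝ) < 2 ^ G.homDim := by positivity
  have hθs : tsupport θ ⊆ closedAnnulus n ((2 : ℝ) ^ G.homDim)⁻¹ 2 := by
    refine closure_minimal (fun x hx => ?_) (isClosed_closedAnnulus _ _)
    by_contra hne
    refine hx ?_
    rw [closedAnnulus, Set.mem_ofPred_eq, not_and_or, not_le, not_le] at hne
    rcases hne with h | h
    · have h1 : ‖G.dilation 2 two_pos x‖ ≤ 1 := by
        refine ((G.dilation 2 two_pos :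
          EuclideanSpace ℝ (Fin n) →L[ℝ] EuclideanSpace ℝ (Fin n)).le_of_opNorm_le
          (G.norm_dilation_le one_le_two) x).trans ?_
        rw [← le_inv_mul_iff₀ hQ, mul_one]
        exact h.le
      have h2 : ‖x‖ ≤ 1 := by
        linarith [G.mul_norm_le_norm_dilation one_le_two x, norm_nonneg x]
      simp [θ, hχ1 _ h1, hχ1 _ h2]
    · have h1 : 2 ≤ ‖G.dilation 2 two_pos x‖ := by
        linarith [G.mul_norm_le_norm_dilation one_le_two x]
      simp [θ, hχ0 _ h1, hχ0 _ h.le]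
  have hθc : HasCompactSupport θ := HasCompactSupport.of_support_subset_isCompact
    (isCompact_closedAnnulus _ _) ((subset_tsupport θ).trans hθs)
  let g : ℕ → EuclideanSpace ℝ (Fin n) → ℂ := fun k y => (((2 : ℝ) ^ (-(j * k)) : ℝ) : ℂ) •
    m (G.dilation ((2 : ℝ) ^ k) (by positivity) y)
  have hg (k : ℕ) : ContDiff ℝ ∞ (g k) :=
    (hm.1.comp (G.dilation ((2 : ℝ) ^ k) (by positivity)).contDiff).const_smul _
  let Θ : ℕ → 𝓢(EuclideanSpace ℝ (Fin n), ℂ) := fun k =>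
    (hθc.mul_right (f' := g k)).toSchwartzMap (hθ.mul (hg k))
  let X : 𝓢(EuclideanSpace ℝ (Fin n), ℂ) := (hχc.mul_right (f' := m)).toSchwartzMap (hχ.mul hm.1)
  have hΘb : Bornology.IsVonNBounded ℂ (Set.range Θ) :=
    isVonNBounded_range_of_cutoff (hθc.toSchwartzMap hθ) hθs hg
      (exists_rescaled_multiplier_bound ν hm (inv_pos.2 hQ) 2) fun k x => rfl
  refine ⟨fun k => if k = 0 then X else Θ k, ⟨?_, fun k hk => ?_⟩, fun ξ => ?_⟩
  · refine ((Bornology.isVonNBounded_singleton X).union hΘb).subset ?_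
    rintro _ ⟨k, rfl⟩
    by_cases hk : k = 0
    · simp [hk]
    · simp [hk]
  · have hk0 : k ≠ 0 := by lia
    simp only [hk0, if_false]
    refine mem_schwartzZeroMomentsHat_of_notMem_tsupport fun h => ?_
    have h1 := hθs ((tsupport_mul_subset_left (f := θ) (g := g k)) h)
    rw [closedAnnulus, Set.mem_ofPred_eq, norm_zero] at h1
    exact absurd h1.1 (not_le.2 (inv_pos.2 hQ))
  · -- the partial sums telescope
    set a : ℕ → ℂ := fun k => χ (G.dilation ((2 : ℝ) ^ (-(k : ℤ))) (by positivity) ξ) * m ξ with ha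
    have h0 : G.multTerm j (fun k => if k = 0 then X else Θ k) 0 ξ = a 0 := by
      have e : G.dilation ((2 : ℝ) ^ (-((0 : ℕ) : ℤ))) (by positivity) ξ = ξ := by
        ext i
        simp [dilation_apply]
      rw [multTerm_apply]
      simp only [if_true, ha, e]
      simp [X]
    have hs (k : ℕ) : G.multTerm j (fun k => if k = 0 then X else Θ k) (k + 1) ξ =
        a (k + 1) - a k := by
      rw [multTerm_apply]
      simp only [Nat.add_eq_zero_iff, one_ne_zero, and_false, if_false]
      have e1 : G.dilation 2 two_pos
          (G.dilation ((2 : ℝ) ^ (-((k + 1 : ℕ) : ℤ))) (by positivity) ξ) =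
          G.dilation ((2 : ℝ) ^ (-(k : ℤ))) (by positivity) ξ := by
        rw [G.dilation_dilation]
        congr 2
        rw [← zpow_one_add₀ two_ne_zero]
        congr 1
        push_cast; ring
      have e2 : G.dilation ((2 : ℝ) ^ (k + 1)) (by positivity)
          (G.dilation ((2 : ℝ) ^ (-((k + 1 : ℕ) : ℤ))) (by positivity) ξ) = ξ := by
        refine G.dilation_dilation_of_mul_eq_one _ _ ?_ ξ
        rw [zpow_neg, zpow_natCast, mul_inv_cancel₀ (by positivity)]
      change (2 : ℝ) ^ (j * ((k + 1 : ℕ) : ℝ)) •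
        ((χ _ - χ (G.dilation 2 two_pos _)) * ((((2 : ℝ) ^ (-(j * ((k + 1 : ℕ) : ℝ))) : ℝ) : ℂ) •
          m (G.dilation ((2 : ℝ) ^ (k + 1)) _ _))) = _
      rw [e1, e2, Complex.coe_smul, mul_smul_comm, smul_smul, ← Real.rpow_add two_pos,
        add_neg_cancel, Real.rpow_zero, one_smul]
      ring
    have hsum (N : ℕ) : ∑ k ∈ Finset.range (N + 1),
        G.multTerm j (fun k => if k = 0 then X else Θ k) k ξ = a N := by
      rw [Finset.sum_range_succ', h0]
      simp only [hs]
      rw [Finset.sum_range_sub]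
      ring
    rw [← tendsto_add_atTop_iff_nat 1]
    simp only [hsum]
    refine tendsto_const_nhds.congr' ?_
    filter_upwards [(tendsto_pow_atTop_atTop_of_one_lt (one_lt_two (α := ℝ))).eventually_ge_atTop ‖ξ‖]
      with N hN
    have hy := G.mul_norm_le_norm_dilation (r := (2 : ℝ) ^ N) (one_le_pow₀ one_le_two)
      (G.dilation ((2 : ℝ) ^ (-(N : ℤ))) (by positivity) ξ)
    rw [G.dilation_dilation_of_mul_eq_one _ _
      (by rw [zpow_neg, zpow_natCast, mul_inv_cancel₀ (by positivity)])] at hy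
    have h1 : ‖G.dilation ((2 : ℝ) ^ (-(N : ℤ))) (by positivity) ξ‖ ≤ 1 := by
      have h2 : (0 : ℝ) < 2 ^ N := by positivity
      by_contra hlt
      nlinarith [not_le.1 hlt]
    simp only [ha]
    rw [hχ1 _ h1, one_mul]

end HomogeneousGroup

/-! ### Kernels away from the origin -/

section Cutoff

variable {n : ℕ}

theorem hasTemperateGrowth_one_sub {ζ : EuclideanSpace ℝ (Fin n) → ℂ} (hζ : ContDiff ℝ ∞ ζ)
    (hζc : HasCompactSupport ζ) : Function.HasTemperateGrowth fun x => 1 - ζ x :=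
  (Function.HasTemperateGrowth.const 1).sub (hζc.hasTemperateGrowth hζ)

theorem exists_cutoff {ρ : ℝ} (hρ : 0 < ρ) : ∃ ζ : EuclideanSpace ℝ (Fin n) → ℂ,
    ContDiff ℝ ∞ ζ ∧ HasCompactSupport ζ ∧ (∀ᶠ x in 𝓝 0, ζ x = 1) ∧ ∀ x, ρ ≤ ‖x‖ → ζ x = 0 := by
  let b : ContDiffBump (0 : EuclideanSpace ℝ (Fin n)) := ⟨ρ / 2, ρ, by positivity, by linarith⟩
  refine ⟨fun x => (b x : ℂ), Complex.ofRealCLM.contDiff.comp b.contDiff,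
    b.hasCompactSupport.comp_left Complex.ofReal_zero, ?_, fun x hx => ?_⟩
  · filter_upwards [b.eventuallyEq_one] with x hx
    rw [hx]; simp
  · have : b x = 0 := b.zero_of_le_dist (by simpa using hx)
    simp [this]

/-- Multiplying by `h`, which vanishes near the origin, a family of Schwartz functions that tends
to `0` geometrically away from the origin. -/
theorem exists_smulLeftCLM_bound {h : EuclideanSpace ℝ (Fin n) → ℂ}
    (hh : Function.HasTemperateGrowth h) {ε : ℝ} (h0 : ∀ x, ‖x‖ < ε → h x = 0)
    {f : ℕ → 𝓢(EuclideanSpace ℝ (Fin n), ℂ)}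
    (hf : ∀ p l, ∃ D : ℝ, 0 ≤ D ∧ ∀ k x, ε ≤ ‖x‖ →
      (1 + ‖x‖) ^ p * ‖iteratedFDeriv ℝ l (f k) x‖ ≤ D * (1 / 2) ^ k) (p l : ℕ) :
    ∃ D : ℝ, 0 ≤ D ∧ ∀ k x,
      ‖x‖ ^ p * ‖iteratedFDeriv ℝ l (SchwartzMap.smulLeftCLM ℂ h (f k)) x‖ ≤
        D * (1 / 2) ^ k := by
  obtain ⟨K, C, hC, hCb⟩ := hh.norm_iteratedFDeriv_le_uniform l
  choose D hD0 hD using hf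
  refine ⟨∑ i ∈ Finset.range (l + 1), (l.choose i : ℝ) * C * D (p + K) (l - i),
    Finset.sum_nonneg fun i _ => mul_nonneg (by positivity) (hD0 _ _), fun k x => ?_⟩
  have e : (SchwartzMap.smulLeftCLM ℂ h (f k) : EuclideanSpace ℝ (Fin n) → ℂ) =
      fun x => h x * f k x := by
    rw [SchwartzMap.smulLeftCLM_apply hh]; rfl
  rw [e]
  by_cases hx : ε ≤ ‖x‖
  · have h1 := norm_iteratedFDeriv_mul_le hh.1 ((f k).smooth ⊤) x (natCast_le_infty l)
    refine (mul_le_mul_of_nonneg_left h1 (by positivity)).trans ?_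
    rw [Finset.mul_sum, Finset.sum_mul]
    refine Finset.sum_le_sum fun i hi => ?_
    have h2 := hCb i (Nat.lt_succ_iff.1 (Finset.mem_range.1 hi)) x
    calc ‖x‖ ^ p * ((l.choose i : ℝ) * ‖iteratedFDeriv ℝ i h x‖ *
          ‖iteratedFDeriv ℝ (l - i) (f k) x‖)
        ≤ (1 + ‖x‖) ^ p * ((l.choose i : ℝ) * (C * (1 + ‖x‖) ^ K) *
          ‖iteratedFDeriv ℝ (l - i) (f k) x‖) := by
          gcongr
          linarith
      _ = (l.choose i : ℝ) * C * ((1 + ‖x‖) ^ (p + K) *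
          ‖iteratedFDeriv ℝ (l - i) (f k) x‖) := by rw [pow_add]; ring
      _ ≤ (l.choose i : ℝ) * C * (D (p + K) (l - i) * (1 / 2) ^ k) :=
          mul_le_mul_of_nonneg_left (hD _ _ k x hx) (by positivity)
      _ = _ := by ring
  · have h1 : tsupport (fun x => h x * f k x) ⊆ {x | ε ≤ ‖x‖} :=
      closure_minimal (fun y hy => by
        by_contra hne
        exact hy (by simp [h0 y (not_le.1 hne)])) (isClosed_le continuous_const continuous_norm)
    have h2 : iteratedFDeriv ℝ l (fun x => h x * f k x) x = 0 := by
      by_contra hne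
      exact hx (h1 (support_iteratedFDeriv_subset l hne))
    rw [h2, norm_zero, mul_zero]
    exact mul_nonneg (Finset.sum_nonneg fun i _ => mul_nonneg (by positivity) (hD0 _ _))
      (by positivity)

theorem summable_schwartzNorm {f : ℕ → 𝓢(EuclideanSpace ℝ (Fin n), ℂ)}
    (hf : ∀ p l, Summable fun k => SchwartzMap.seminorm ℂ p l (f k)) (N : ℕ) :
    Summable fun k => schwartzNorm N (f k) := by
  refine Summable.of_nonneg_of_le (fun k => schwartzNorm_nonneg N _) (fun k => ?_)
    (summable_sum (s := Finset.Iic (N, N)) fun i _ => hf i.1 i.2)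
  exact Seminorm.finset_sup_apply_le (Finset.sum_nonneg fun i _ => apply_nonneg _ _) fun i hi =>
    Finset.single_le_sum (f := fun i : ℕ × ℕ => SchwartzMap.seminorm ℂ i.1 i.2 (f k))
      (fun i _ => apply_nonneg _ _) hi

theorem smulLeftCLM_schwartzToDist {h : EuclideanSpace ℝ (Fin n) → ℂ}
    (hh : Function.HasTemperateGrowth h) (f : 𝓢(EuclideanSpace ℝ (Fin n), ℂ)) :
    TemperedDistribution.smulLeftCLM ℂ h (schwartzToDist f) =
      schwartzToDist (SchwartzMap.smulLeftCLM ℂ h f) := by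
  refine DFunLike.ext _ _ fun g => ?_
  rw [TemperedDistribution.smulLeftCLM_apply_apply, schwartzToDist_apply, schwartzToDist_apply]
  simp only [SchwartzMap.smulLeftCLM_apply_apply hh, smul_eq_mul]
  refine integral_congr_ae (Eventually.of_forall fun x => ?_)
  ring

theorem isCompact_dsupport_smulLeftCLM {ζ : EuclideanSpace ℝ (Fin n) → ℂ} (hζ : ContDiff ℝ ∞ ζ)
    (hζc : HasCompactSupport ζ) (K : 𝓢'(EuclideanSpace ℝ (Fin n), ℂ)) :
    IsCompact (Distribution.dsupport (TemperedDistribution.smulLeftCLM ℂ ζ K)) := by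
  refine hζc.isCompact.of_isClosed_subset Distribution.isClosed_dsupport
    (Set.sInter_subset_of_mem ⟨fun u hu => ?_, isClosed_tsupport ζ⟩)
  have h0 : SchwartzMap.smulLeftCLM ℂ ζ u = 0 := by
    ext x
    rw [SchwartzMap.smulLeftCLM_apply_apply (hζc.hasTemperateGrowth hζ)]
    by_cases hx : x ∈ tsupport ζ
    · have : u x = 0 := image_eq_zero_of_notMem_tsupport fun hxu => hu hxu hx
      simp [this]
    · simp [image_eq_zero_of_notMem_tsupport hx]
  rw [TemperedDistribution.smulLeftCLM_apply_apply, h0, map_zero]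

end Cutoff

namespace HomogeneousGroup

variable {n : ℕ} [NeZero n] (G : HomogeneousGroup n)

/-- Away from the origin the dyadic pieces of a kernel decay geometrically, with all derivatives:
there `‖δ_{2 ^ k} x‖` is at least of order `2 ^ k`, and the rapid decay of `φ_k` beats the powers
of `2 ^ k` produced by the scaling. -/
theorem exists_kernelTerm_bound (j : ℝ) {φ : ℕ → 𝓢(EuclideanSpace ℝ (Fin n), ℂ)}
    (hφ : Bornology.IsVonNBounded ℂ (Set.range φ)) {ε : ℝ} (hε : 0 < ε) (p l : ℕ) :
    ∃ D : ℝ, 0 ≤ D ∧ ∀ k x, ε ≤ ‖x‖ →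
      (1 + ‖x‖) ^ p * ‖iteratedFDeriv ℝ l (G.kernelTerm j φ k) x‖ ≤ D * (1 / 2) ^ k := by
  set Q := G.homDim
  set q : ℕ := ⌈j + Q + Q * l + 1⌉₊ with hq
  obtain ⟨B, hB0, hB⟩ := isVonNBounded_range_iff_schwartzNorm.1 hφ (max (p + q) l)
  refine ⟨(1 + ε⁻¹) ^ p * B * (ε⁻¹) ^ q, by positivity, fun k x hx => ?_⟩
  have hk1 : (1 : ℝ) ≤ 2 ^ (k : ℤ) := by rw [zpow_natCast]; exact one_le_pow₀ one_le_two
  have hx0 : 0 < ‖x‖ := hε.trans_le hx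
  set y := G.dilation ((2 : ℝ) ^ (k : ℤ)) (by positivity) x with hy
  have hyx : 2 ^ k * ‖x‖ ≤ ‖y‖ := by
    rw [← zpow_natCast]
    exact G.mul_norm_le_norm_dilation hk1 x
  -- the chain rule
  have h1 : ‖iteratedFDeriv ℝ l (G.kernelTerm j φ k) x‖ ≤
      (2 : ℝ) ^ ((j + Q) * k) * (‖iteratedFDeriv ℝ l (φ k) y‖ * ((2 : ℝ) ^ (Q * l * k))) := by
    have hs : ContDiff ℝ ∞ (φ k) := (φ k).smooth ⊤
    let L : EuclideanSpace ℝ (Fin n) →L[ℝ] EuclideanSpace ℝ (Fin n) :=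
      G.dilation ((2 : ℝ) ^ (k : ℤ)) (by positivity)
    have e : (G.kernelTerm j φ k : EuclideanSpace ℝ (Fin n) → ℂ) =
      (((2 : ℝ) ^ ((j + Q) * k) : ℝ) : ℂ) • (φ k ∘ L) := rfl
    rw [e, iteratedFDeriv_const_smul_apply
      ((hs.comp L.contDiff).contDiffAt.of_le (natCast_le_infty l)), norm_smul, Complex.norm_real,
      Real.norm_of_nonneg (by positivity), L.iteratedFDeriv_comp_right hs x (natCast_le_infty l)]
    refine mul_le_mul_of_nonneg_left ?_ (by positivity)
    refine (ContinuousMultilinearMap.norm_compContinuousLinearMap_le _ _).trans ?_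
    refine mul_le_mul_of_nonneg_left ?_ (norm_nonneg _)
    rw [Finset.prod_const, Finset.card_univ, Fintype.card_fin]
    refine (pow_le_pow_left₀ (norm_nonneg _) (G.norm_dilation_le hk1) l).trans (le_of_eq ?_)
    rw [zpow_natCast, ← Real.rpow_natCast, ← Real.rpow_natCast, ← Real.rpow_mul zero_le_two,
      ← Real.rpow_mul zero_le_two]
    congr 1
    simp only [Q]
    ring
  have h2 : (2 ^ k * ‖x‖) ^ (p + q) * ‖iteratedFDeriv ℝ l (φ k) y‖ ≤ B :=
    (mul_le_mul_of_nonneg_right (pow_le_pow_left₀ (by positivity) hyx _) (norm_nonneg _)).trans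
      ((pow_mul_norm_iteratedFDeriv_le_schwartzNorm (le_max_left _ _) (le_max_right _ _) _ y).trans
        (hB k))
  have h3 : 1 + ‖x‖ ≤ (1 + ε⁻¹) * ‖x‖ := by
    have : 1 ≤ ε⁻¹ * ‖x‖ := by rw [inv_mul_eq_div]; exact (one_le_div hε).2 hx
    linarith
  have h4 : (1 + ‖x‖) ^ p * ‖iteratedFDeriv ℝ l (φ k) y‖ ≤
      (1 + ε⁻¹) ^ p * B * (ε⁻¹) ^ q * ((2 : ℝ) ^ k)⁻¹ ^ q := by
    have h5 : 1 ≤ (2 ^ k : ℝ) ^ p * (ε⁻¹ * ‖x‖) ^ q := by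
      refine one_le_mul_of_one_le_of_one_le (one_le_pow₀ (one_le_pow₀ one_le_two))
        (one_le_pow₀ ?_)
      rw [inv_mul_eq_div]; exact (one_le_div hε).2 hx
    calc (1 + ‖x‖) ^ p * ‖iteratedFDeriv ℝ l (φ k) y‖
        ≤ ((1 + ε⁻¹) * ‖x‖) ^ p * ‖iteratedFDeriv ℝ l (φ k) y‖ * 1 := by
          rw [mul_one]; gcongr
      _ ≤ ((1 + ε⁻¹) * ‖x‖) ^ p * ‖iteratedFDeriv ℝ l (φ k) y‖ *
          ((2 ^ k : ℝ) ^ p * (ε⁻¹ * ‖x‖) ^ q) := by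
          refine mul_le_mul_of_nonneg_left h5 (by positivity)
      _ = (1 + ε⁻¹) ^ p * ((2 ^ k * ‖x‖) ^ (p + q) * ‖iteratedFDeriv ℝ l (φ k) y‖) *
          (ε⁻¹) ^ q * ((2 : ℝ) ^ k)⁻¹ ^ q := by
          have : (2 ^ k : ℝ) ^ q * ((2 : ℝ) ^ k)⁻¹ ^ q = 1 := by
            rw [← mul_pow, mul_inv_cancel₀ (by positivity), one_pow]
          simp only [mul_pow, pow_add]
          linear_combination (-((1 + ε⁻¹) ^ p * ‖x‖ ^ p * ‖iteratedFDeriv ℝ l (φ k) y‖ *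
            (2 ^ k : ℝ) ^ p * (ε⁻¹) ^ q * ‖x‖ ^ q)) * this
      _ ≤ _ := by gcongr
  have h6 : (2 : ℝ) ^ ((j + Q) * k) * (2 : ℝ) ^ (Q * l * k) * ((2 : ℝ) ^ k)⁻¹ ^ q ≤
      (1 / 2) ^ k := by
    have e1 : ((2 : ℝ) ^ k)⁻¹ ^ q = (2 : ℝ) ^ (-(k * q : ℝ)) := by
      rw [Real.rpow_neg zero_le_two, Real.rpow_mul zero_le_two, Real.rpow_natCast,
        Real.rpow_natCast, inv_pow]
    have e2 : (1 / 2 : ℝ) ^ k = (2 : ℝ) ^ (-(k : ℝ)) := by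
      rw [Real.rpow_neg zero_le_two, Real.rpow_natCast, one_div, inv_pow]
    rw [e1, e2, ← Real.rpow_add two_pos, ← Real.rpow_add two_pos]
    refine Real.rpow_le_rpow_of_exponent_le one_le_two ?_
    have hq1 : j + Q + Q * l + 1 ≤ q := Nat.le_ceil _
    nlinarith [mul_le_mul_of_nonneg_left hq1 (Nat.cast_nonneg (α := ℝ) k)]
  calc (1 + ‖x‖) ^ p * ‖iteratedFDeriv ℝ l (G.kernelTerm j φ k) x‖
      ≤ (1 + ‖x‖) ^ p * ((2 : ℝ) ^ ((j + Q) * k) *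
        (‖iteratedFDeriv ℝ l (φ k) y‖ * ((2 : ℝ) ^ (Q * l * k)))) := by gcongr
    _ = (2 : ℝ) ^ ((j + Q) * k) * (2 : ℝ) ^ (Q * l * k) *
        ((1 + ‖x‖) ^ p * ‖iteratedFDeriv ℝ l (φ k) y‖) := by ring
    _ ≤ (2 : ℝ) ^ ((j + Q) * k) * (2 : ℝ) ^ (Q * l * k) *
        ((1 + ε⁻¹) ^ p * B * (ε⁻¹) ^ q * ((2 : ℝ) ^ k)⁻¹ ^ q) := by gcongr
    _ = (1 + ε⁻¹) ^ p * B * (ε⁻¹) ^ q *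
        ((2 : ℝ) ^ ((j + Q) * k) * (2 : ℝ) ^ (Q * l * k) * ((2 : ℝ) ^ k)⁻¹ ^ q) := by ring
    _ ≤ _ := mul_le_mul_of_nonneg_left h6 (by positivity)

/-- Away from the origin a kernel is the absolutely convergent sum, in the Schwartz space, of its
dyadic pieces. -/
theorem summable_and_exists_hasSum_one_sub_kernelTerm {j : ℝ}
    {φ : ℕ → 𝓢(EuclideanSpace ℝ (Fin n), ℂ)}
    (hφ : Bornology.IsVonNBounded ℂ (Set.range φ)) {K : 𝓢'(EuclideanSpace ℝ (Fin n), ℂ)}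
    (hK : Tendsto (fun N => ∑ k ∈ Finset.range N, schwartzToDist (G.kernelTerm j φ k))
      atTop (𝓝 K)) {ζ : EuclideanSpace ℝ (Fin n) → ℂ} (hζ : ContDiff ℝ ∞ ζ)
    (hζc : HasCompactSupport ζ) (hζ1 : ∀ᶠ x in 𝓝 0, ζ x = 1) :
    (∀ N : ℕ, Summable fun k =>
      schwartzNorm N (SchwartzMap.smulLeftCLM ℂ (fun x => 1 - ζ x) (G.kernelTerm j φ k))) ∧
    ∃ g : 𝓢(EuclideanSpace ℝ (Fin n), ℂ),
      HasSum (fun k => SchwartzMap.smulLeftCLM ℂ (fun x => 1 - ζ x) (G.kernelTerm j φ k)) g ∧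
      TemperedDistribution.smulLeftCLM ℂ (fun x => 1 - ζ x) K = schwartzToDist g := by
  have hh := hasTemperateGrowth_one_sub hζ hζc
  obtain ⟨ε, hε, hεb⟩ := Metric.eventually_nhds_iff.1 hζ1
  have hb := exists_smulLeftCLM_bound hh (ε := ε)
    (fun x hx => by rw [hεb (by simpa using hx), sub_self])
    (G.exists_kernelTerm_bound j hφ hε)
  have hsum (p l : ℕ) : Summable fun k => SchwartzMap.seminorm ℂ p l
      (SchwartzMap.smulLeftCLM ℂ (fun x => 1 - ζ x) (G.kernelTerm j φ k)) := by
    obtain ⟨D, hD0, hD⟩ := hb p l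
    exact Summable.of_nonneg_of_le (fun k => apply_nonneg _ _)
      (fun k => SchwartzMap.seminorm_le_bound ℂ p l _ (by positivity) (hD k))
      (summable_geometric_two.mul_left D)
  have hsumR (p l : ℕ) : Summable fun k => SchwartzMap.seminorm ℝ p l
      (SchwartzMap.smulLeftCLM ℂ (fun x => 1 - ζ x) (G.kernelTerm j φ k)) := hsum p l
  refine ⟨summable_schwartzNorm hsum, ?_⟩
  obtain ⟨g, hg⟩ := SchwartzMap.exists_hasSum_of_summable_seminorm hsumR
  refine ⟨g, hg, ?_⟩
  have h1 := ((TemperedDistribution.smulLeftCLM ℂ fun x => 1 - ζ x).continuous.tendsto K).comp hK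
  have h2 := ((SchwartzMap.toTemperedDistributionCLM (EuclideanSpace ℝ (Fin n)) ℂ
    volume).continuous.tendsto g).comp hg.tendsto_sum_nat
  refine tendsto_nhds_unique h1 (h2.congr fun N => ?_)
  change schwartzToDist _ = TemperedDistribution.smulLeftCLM ℂ _ (∑ k ∈ Finset.range N, _)
  rw [schwartzToDist_sum, map_sum]
  exact Finset.sum_congr rfl fun k _ => (smulLeftCLM_schwartzToDist hh _).symm

theorem isSmoothAwayFromZero_of_tendsto {j : ℝ}
    {φ : ℕ → 𝓢(EuclideanSpace ℝ (Fin n), ℂ)}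
    (hφ : Bornology.IsVonNBounded ℂ (Set.range φ)) {K : 𝓢'(EuclideanSpace ℝ (Fin n), ℂ)}
    (hK : Tendsto (fun N => ∑ k ∈ Finset.range N, schwartzToDist (G.kernelTerm j φ k))
      atTop (𝓝 K)) : IsSmoothAwayFromZero K := by
  -- outside every ball around the origin the pointwise sum of the series is a Schwartz function
  have key (ρ : ℝ) (hρ : 0 < ρ) : ∃ (h : EuclideanSpace ℝ (Fin n) → ℂ)
      (g : 𝓢(EuclideanSpace ℝ (Fin n), ℂ)), Function.HasTemperateGrowth h ∧
      (∀ x, ρ ≤ ‖x‖ → h x = 1) ∧ (∀ x, ρ ≤ ‖x‖ → ∑' k, G.kernelTerm j φ k x = g x) ∧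
      TemperedDistribution.smulLeftCLM ℂ h K = schwartzToDist g := by
    obtain ⟨ζ, hζ, hζc, hζ1, hζ0⟩ := exists_cutoff (n := n) hρ
    obtain ⟨-, g, hg, hKg⟩ :=
      G.summable_and_exists_hasSum_one_sub_kernelTerm hφ hK hζ hζc hζ1
    have hh := hasTemperateGrowth_one_sub hζ hζc
    refine ⟨_, g, hh, fun x hx => by rw [hζ0 x hx, sub_zero], fun x hx => ?_, hKg⟩
    have h1 := hg.map (TemperedDistribution.delta x) (TemperedDistribution.delta x).continuous
    refine HasSum.tsum_eq (h1.congr_fun fun k => ?_)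
    simp [SchwartzMap.smulLeftCLM_apply_apply hh, hζ0 x hx]
  refine ⟨fun x => ∑' k, G.kernelTerm j φ k x, fun x hx => ?_, fun u _ hu => ?_⟩
  · have hx0 : 0 < ‖x‖ := norm_pos_iff.2 hx
    obtain ⟨h, g, -, -, hg, -⟩ := key (‖x‖ / 2) (by positivity)
    refine ContDiffAt.contDiffWithinAt ?_
    refine ((g.smooth ⊤).contDiffAt (x := x)).congr_of_eventuallyEq ?_
    filter_upwards [continuous_norm.continuousAt.eventually
      (eventually_ge_nhds (show ‖x‖ / 2 < ‖x‖ by linarith))] with y hy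
    exact hg y hy
  · have h0 : (tsupport u)ᶜ ∈ 𝓝 (0 : EuclideanSpace ℝ (Fin n)) :=
      (isClosed_tsupport u).isOpen_compl.mem_nhds fun h => hu h rfl
    obtain ⟨ρ, hρ, hρu⟩ := Metric.mem_nhds_iff.1 h0
    have hu0 (x : EuclideanSpace ℝ (Fin n)) (hx : ‖x‖ < ρ) : u x = 0 :=
      image_eq_zero_of_notMem_tsupport (hρu (by simpa using hx))
    obtain ⟨h, g, hh, h1, hg, hKg⟩ := key ρ hρ
    have e : SchwartzMap.smulLeftCLM ℂ h u = u := by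
      ext x
      rw [SchwartzMap.smulLeftCLM_apply_apply hh]
      rcases lt_or_ge ‖x‖ ρ with hx | hx
      · simp [hu0 x hx]
      · simp [h1 x hx]
    have h2 : K u = schwartzToDist g u := by
      rw [← hKg, TemperedDistribution.smulLeftCLM_apply_apply, e]
    rw [h2, schwartzToDist_apply]
    refine integral_congr_ae (Eventually.of_forall fun x => ?_)
    rcases lt_or_ge ‖x‖ ρ with hx | hx
    · simp [hu0 x hx]
    · simp only [hg x hx]

variable {G} (ν : G.HomogeneousNorm)

/-! ### Inverse Fourier transforms of multipliers -/

theorem sum_schwartzToDist_kernelTerm (j : ℝ) (ψ : ℕ → 𝓢(EuclideanSpace ℝ (Fin n), ℂ)) (N : ℕ) :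
    ∑ k ∈ Finset.range N, schwartzToDist (G.kernelTerm j (fun i => 𝓕⁻ (ψ i)) k) =
      𝓕⁻ (∑ k ∈ Finset.range N, schwartzToDist (G.multTerm j ψ k)) := by
  have h := map_sum (FourierTransform.fourierInvCLM ℂ 𝓢'(EuclideanSpace ℝ (Fin n), ℂ))
    (fun k => schwartzToDist (G.multTerm j ψ k)) (Finset.range N)
  simp only [FourierTransform.fourierInvCLM_apply] at h
  rw [h]
  refine Finset.sum_congr rfl fun k _ => ?_
  rw [← fourierInv_multTerm, schwartzToDist_fourierInv]

theorem exists_mem_multipliersCheck_tendsto {j : ℝ} {φ : ℕ → 𝓢(EuclideanSpace ℝ (Fin n), ℂ)}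
    (hφ : IsBoundedSeqIn (schwartzZeroMoments n) φ) :
    ∃ K ∈ multipliersCheck ν j,
      Tendsto (fun N => ∑ k ∈ Finset.range N, schwartzToDist (G.kernelTerm j φ k))
        atTop (𝓝 K) := by
  obtain ⟨T, hT, hlim⟩ := exists_tendsto_schwartzToDist_multTerm ν (j := j) hφ.fourier
  refine ⟨𝓕⁻ T, ⟨_, tsum_multTerm_mem_multipliers ν hφ.fourier, T, hT, rfl⟩, ?_⟩
  have h := ((FourierTransform.fourierInvCLM ℂ
    𝓢'(EuclideanSpace ℝ (Fin n), ℂ)).continuous.tendsto T).comp hlim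
  refine h.congr fun N => ?_
  have e := sum_schwartzToDist_kernelTerm (G := G) j (fun k => 𝓕 (φ k)) N
  simp only [FourierTransform.fourierInv_fourier_eq] at e
  exact e.symm

theorem mem_multipliersCheck_iff {j : ℝ} {K : 𝓢'(EuclideanSpace ℝ (Fin n), ℂ)} :
    K ∈ multipliersCheck ν j ↔
      ∃ φ : ℕ → 𝓢(EuclideanSpace ℝ (Fin n), ℂ), IsBoundedSeqIn (schwartzZeroMoments n) φ ∧
        Tendsto (fun N => ∑ k ∈ Finset.range N, schwartzToDist (G.kernelTerm j φ k))
          atTop (𝓝 K) := by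
  constructor
  · rintro ⟨m, hm, T, hT, rfl⟩
    obtain ⟨ψ, hψ, hlim⟩ := exists_dyadic_decomposition ν hm
    obtain rfl : m = fun ξ => ∑' k, G.multTerm j ψ k ξ :=
      funext fun ξ => tendsto_nhds_unique (hlim ξ) (hasSum_multTerm ν hψ ξ).tendsto_sum_nat
    obtain ⟨T', hT', hlim'⟩ := exists_tendsto_schwartzToDist_multTerm ν (j := j) hψ
    obtain rfl := hT.unique hT'
    refine ⟨_, hψ.fourierInv, ?_⟩
    simp only [sum_schwartzToDist_kernelTerm]
    exact ((FourierTransform.fourierInvCLM ℂ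
      𝓢'(EuclideanSpace ℝ (Fin n), ℂ)).continuous.tendsto T).comp hlim'
  · rintro ⟨φ, hφ, hlim⟩
    obtain ⟨K', hK', hlim'⟩ := exists_mem_multipliersCheck_tendsto ν (j := j) hφ
    rwa [tendsto_nhds_unique hlim hlim']

end HomogeneousGroup

theorem mainTheorem2 (n : ℕ) [NeZero n] (G : HomogeneousGroup n) (ν : G.HomogeneousNorm) (j : ℝ) :
    -- dyadic decomposition of a multiplier
    (∀ m ∈ HomogeneousGroup.multipliers ν j,
      ∃ ψ : ℕ → 𝓢(EuclideanSpace ℝ (Fin n), ℂ),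
        IsBoundedSeqIn (schwartzZeroMomentsHat n) ψ ∧
        (∀ ξ, Tendsto (fun N => ∑ k ∈ Finset.range N, G.multTerm j ψ k ξ) atTop (𝓝 (m ξ))) ∧
        ∃ T : 𝓢'(EuclideanSpace ℝ (Fin n), ℂ), IsGivenBy T m ∧
          Tendsto (fun N => ∑ k ∈ Finset.range N, schwartzToDist (G.multTerm j ψ k)) atTop (𝓝 T)) ∧
    -- the inverse Fourier transforms of the terms
    (∀ (ψ : ℕ → 𝓢(EuclideanSpace ℝ (Fin n), ℂ)) (k : ℕ),
      𝓕⁻ (G.multTerm j ψ k) = G.kernelTerm j (fun i => 𝓕⁻ (ψ i)) k) ∧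
    -- converse: every such series converges to a multiplier, in several senses
    (∀ ψ : ℕ → 𝓢(EuclideanSpace ℝ (Fin n), ℂ), IsBoundedSeqIn (schwartzZeroMomentsHat n) ψ →
      ∃ m ∈ HomogeneousGroup.multipliers ν j,
        TendstoSmooth (fun N ξ => ∑ k ∈ Finset.range N, G.multTerm j ψ k ξ) m ∧
        (∃ T : 𝓢'(EuclideanSpace ℝ (Fin n), ℂ), IsGivenBy T m ∧
          Tendsto (fun N => ∑ k ∈ Finset.range N, schwartzToDist (G.multTerm j ψ k))
            atTop (𝓝 T)) ∧
        ∀ j' : ℝ, j < j' →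
          m ∈ HomogeneousGroup.multipliers ν j' ∧
          (∀ N : ℕ, (fun ξ => ∑ k ∈ Finset.range N, G.multTerm j ψ k ξ) ∈
            HomogeneousGroup.multipliers ν j') ∧
          ∀ I : ℕ, Tendsto
            (fun N => HomogeneousGroup.multiplierNorm ν j' I
              (fun ξ => (∑ k ∈ Finset.range N, G.multTerm j ψ k ξ) - m ξ)) atTop (𝓝 0)) ∧
    -- uniformity of the sum in the norms of order `j`
    (∀ I : ℕ, ∃ (C : ℝ) (J : ℕ), ∀ ψ : ℕ → 𝓢(EuclideanSpace ℝ (Fin n), ℂ),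
      IsBoundedSeqIn (schwartzZeroMomentsHat n) ψ → ∀ m : EuclideanSpace ℝ (Fin n) → ℂ,
        (∀ ξ, Tendsto (fun N => ∑ k ∈ Finset.range N, G.multTerm j ψ k ξ) atTop (𝓝 (m ξ))) →
        HomogeneousGroup.multiplierNorm ν j I m ≤ C * ⨆ k, schwartzNorm J (ψ k)) ∧
    -- uniformity of the sum in the norms of order `j' > j`
    (∀ j' : ℝ, j < j' → ∀ I : ℕ, ∃ (C : ℝ) (J : ℕ),
      ∀ ψ : ℕ → 𝓢(EuclideanSpace ℝ (Fin n), ℂ),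
        IsBoundedSeqIn (schwartzZeroMomentsHat n) ψ → ∀ m : EuclideanSpace ℝ (Fin n) → ℂ,
        (∀ ξ, Tendsto (fun N => ∑ k ∈ Finset.range N, G.multTerm j ψ k ξ) atTop (𝓝 (m ξ))) →
        HomogeneousGroup.multiplierNorm ν j' I m ≤
          C * ⨆ k : ℕ, (2 : ℝ) ^ (-((j' - j) * k)) * schwartzNorm J (ψ k)) ∧
    -- characterization of the inverse Fourier transforms of multipliers
    (∀ K : 𝓢'(EuclideanSpace ℝ (Fin n), ℂ),
      K ∈ HomogeneousGroup.multipliersCheck ν j ↔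
        ∃ φ : ℕ → 𝓢(EuclideanSpace ℝ (Fin n), ℂ), IsBoundedSeqIn (schwartzZeroMoments n) φ ∧
          Tendsto (fun N => ∑ k ∈ Finset.range N, schwartzToDist (G.kernelTerm j φ k))
            atTop (𝓝 K)) ∧
    (∀ φ : ℕ → 𝓢(EuclideanSpace ℝ (Fin n), ℂ), IsBoundedSeqIn (schwartzZeroMoments n) φ →
      ∃ K ∈ HomogeneousGroup.multipliersCheck ν j,
        Tendsto (fun N => ∑ k ∈ Finset.range N, schwartzToDist (G.kernelTerm j φ k))
          atTop (𝓝 K)) ∧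
    -- every element is a compactly supported distribution plus a Schwartz function,
    -- and is smooth away from the origin
    (∀ K ∈ HomogeneousGroup.multipliersCheck ν j,
      (∃ (u : 𝓢'(EuclideanSpace ℝ (Fin n), ℂ)) (g : 𝓢(EuclideanSpace ℝ (Fin n), ℂ)),
        IsCompact (Distribution.dsupport u) ∧ K = u + schwartzToDist g) ∧
      IsSmoothAwayFromZero K) ∧
    -- absolute convergence in the Schwartz space away from the origin
    (∀ K ∈ HomogeneousGroup.multipliersCheck ν j,
      ∀ φ : ℕ → 𝓢(EuclideanSpace ℝ (Fin n), ℂ), IsBoundedSeqIn (schwartzZeroMoments n) φ →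
        Tendsto (fun N => ∑ k ∈ Finset.range N, schwartzToDist (G.kernelTerm j φ k))
          atTop (𝓝 K) →
        ∀ ζ : EuclideanSpace ℝ (Fin n) → ℂ, ContDiff ℝ ∞ ζ → HasCompactSupport ζ →
          (∀ᶠ x in 𝓝 0, ζ x = 1) →
          (∀ N : ℕ, Summable fun k =>
            schwartzNorm N (SchwartzMap.smulLeftCLM ℂ (fun x => 1 - ζ x) (G.kernelTerm j φ k))) ∧
          ∃ g : 𝓢(EuclideanSpace ℝ (Fin n), ℂ),
            HasSum (fun k => SchwartzMap.smulLeftCLM ℂ (fun x => 1 - ζ x) (G.kernelTerm j φ k)) g ∧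
            TemperedDistribution.smulLeftCLM ℂ (fun x => 1 - ζ x) K = schwartzToDist g) := by
  have hdec : ∀ K ∈ HomogeneousGroup.multipliersCheck ν j,
      ∃ φ : ℕ → 𝓢(EuclideanSpace ℝ (Fin n), ℂ), IsBoundedSeqIn (schwartzZeroMoments n) φ ∧
        Tendsto (fun N => ∑ k ∈ Finset.range N, schwartzToDist (G.kernelTerm j φ k))
          atTop (𝓝 K) :=
    fun K hK => (HomogeneousGroup.mem_multipliersCheck_iff ν).1 hK
  refine ⟨fun m hm => ?_, G.fourierInv_multTerm j, fun ψ hψ => ?_, fun I => ?_, fun j' hj I => ?_,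
    fun K => HomogeneousGroup.mem_multipliersCheck_iff ν,
    fun φ hφ => HomogeneousGroup.exists_mem_multipliersCheck_tendsto ν hφ, fun K hK => ⟨?_, ?_⟩,
    fun K _ φ hφ hlim ζ hζ hζc hζ1 =>
      G.summable_and_exists_hasSum_one_sub_kernelTerm hφ.1 hlim hζ hζc hζ1⟩
  · obtain ⟨ψ, hψ, hlim⟩ := HomogeneousGroup.exists_dyadic_decomposition ν hm
    obtain rfl : m = fun ξ => ∑' k, G.multTerm j ψ k ξ :=
      funext fun ξ => tendsto_nhds_unique (hlim ξ)
        (HomogeneousGroup.hasSum_multTerm ν hψ ξ).tendsto_sum_nat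
    exact ⟨ψ, hψ, hlim, HomogeneousGroup.exists_tendsto_schwartzToDist_multTerm ν hψ⟩
  · have hm := HomogeneousGroup.tsum_multTerm_mem_multipliers ν (j := j) hψ
    refine ⟨_, hm, HomogeneousGroup.tendstoSmooth_sum_multTerm ν hψ,
      HomogeneousGroup.exists_tendsto_schwartzToDist_multTerm ν hψ, fun j' hj => ?_⟩
    exact ⟨HomogeneousGroup.multipliers_mono ν hj.le hm, fun N =>
      HomogeneousGroup.multipliers_mono ν hj.le
        (HomogeneousGroup.sum_multTerm_mem_multipliers ν hψ N),
      HomogeneousGroup.tendsto_multiplierNorm_sum_sub ν hj hψ⟩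
  · obtain ⟨C, J, -, h⟩ := HomogeneousGroup.exists_multiplierNorm_le ν j I
    exact ⟨C, J, h⟩
  · obtain ⟨C, J, -, h⟩ := HomogeneousGroup.exists_multiplierNorm_le_of_lt ν hj I
    exact ⟨C, J, h⟩
  · obtain ⟨φ, hφ, hlim⟩ := hdec K hK
    obtain ⟨ζ, hζ, hζc, hζ1, -⟩ := exists_cutoff (n := n) one_pos
    obtain ⟨-, g, -, hg⟩ :=
      G.summable_and_exists_hasSum_one_sub_kernelTerm hφ.1 hlim hζ hζc hζ1
    refine ⟨TemperedDistribution.smulLeftCLM ℂ ζ K, g, isCompact_dsupport_smulLeftCLM hζ hζc K, ?_⟩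
    have hadd := TemperedDistribution.smulLeftCLM_add (F := ℂ) (hζc.hasTemperateGrowth hζ)
      (hasTemperateGrowth_one_sub hζ hζc)
    have hone : (ζ + fun x => 1 - ζ x) = fun _ => (1 : ℂ) := by
      funext x
      simp
    rw [hone] at hadd
    have h := DFunLike.congr_fun hadd K
    rw [TemperedDistribution.smulLeftCLM_const, one_smul] at h
    rw [← hg]
    exact h
  · obtain ⟨φ, hφ, hlim⟩ := hdec K hK
    exact G.isSmoothAwayFromZero_of_tendsto hφ.1 hlim
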